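/- Let $1\le k\le n$ be integers, let $F$ be any field, and let $F[\mathbf{x}_n]=F[x_1,\dots,x_n]$. Let $J_{n,k}\subseteq F[\mathbf{x}_n]$ be the ideal generated by the complete homogeneous symmetric polynomials $h_k(x_1),h_k(x_1,x_2),\dots,h_k(x_1,\dots,x_n)$ and the elementary symmetric polynomials $e_n(\mathbf{x}_n),e_{n-1}(\mathbf{x}_n),\dots,e_{n-k+1}(\mathbf{x}_n)$, and put $S_{n,k}=F[\mathbf{x}_n]/J_{n,k}$. Let neglex be the lexicographic monomial order with $x_n>\cdots>x_2>x_1$: $x_1^{a_1}\cdots x_n^{a_n}<x_1^{b_1}\cdots x_n^{b_n}$ if and only if for some $j$ one has $a_j<b_j$ and $a_i=b_i$ for all $i>j$. Let $\mathrm{in}_<(J_{n,k})$ be the ideal generated by the neglex-leading terms of the nonzero elements of $J_{n,k}$. For $S=\{s_1<\cdots<s_m\}\subseteq\{1,\dots,n\}$ define the reverse skip monomial $$\mathbf{x}(S)^*=x_{n-s_1+1}^{s_1}\,x_{n-s_2+1}^{s_2-1}\cdots x_{n-s_m+1}^{s_m-m+1}.$$ A monomial $m$ is called $(n,k)$-reverse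 nonskip if $x_i^k\nmid m$ for all $1\le i\le n$ and $\mathbf{x}(S)^*\nmid m$ for all $S\subseteq\{1,\dots,n\}$ with $|S|=n-k+1$. Let $\mathcal{C}_{n,k}$ be the set of these monomials. Theorem. The set of standard monomials $\{m : m\notin \mathrm{in}_<(J_{n,k})\}$ of $J_{n,k}$ with respect to neglex is exactly $\mathcal{C}_{n,k}$, and the images of the monomials in $\mathcal{C}_{n,k}$ form an $F$-basis of $S_{n,k}$; that is, $\mathcal{C}_{n,k}$ is the standard monomial basis of $S_{n,k}$ with respect to neglex. Moreover $\dim_F S_{n,k}=|\mathcal{OP}_{n,k}|$ is finite, where $\mathcal{OP}_{n,k}$ is the set of ordered set partitions of $\{1,\dots,n\}$ into $k$ nonempty blocks. -/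

import Mathlib

open MvPolynomial
open scoped MonomialOrder

/-! Variables are indexed by `Fin n`; the variable usually written `x_i` (`1 ≤ i ≤ n`) is `X` at the
index `i - 1`.  A monomial is represented by its exponent vector `d : Fin n →₀ ℕ`; as a polynomial
it is `monomial d 1`, and divisibility of monomials is the order `≤` on exponent vectors. -/

/-- The lexicographic order with respect to the variable order `x_n > ⋯ > x_2 > x_1`
(Mathlib's colexicographic order on exponent vectors), as a monomial order. -/
noncomputable def neglex (n : ℕ) : MonomialOrder (Fin n) where
  syn := Colex (Fin n →₀ ℕ)
  toSyn :=
    { toEquiv := toColex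
      map_add' := fun _ _ => rfl }
  toSyn_monotone := Finsupp.toColex_monotone

/-- `c` is smaller than `d` iff, at the largest index where they differ, `c` has the smaller
exponent. -/
theorem neglex_lt_iff {n : ℕ} (c d : Fin n →₀ ℕ) :
    c ≺[neglex n] d ↔ ∃ j, (∀ i, j < i → c i = d i) ∧ c j < d j :=
  Iff.rfl

/-- The complete homogeneous symmetric polynomial of degree `k` in the variables of index at
most `i`: this is `h_k(x_1, …, x_{i+1})` in the usual 1-based numbering. -/
noncomputable def partialHsymm (F : Type*) [Field F] {n : ℕ} (k : ℕ) (i : Fin n) :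
    MvPolynomial (Fin n) F :=
  rename Subtype.val (hsymm {j : Fin n // j ≤ i} F k)

/-- The ideal `J_{n,k}` generated by `h_k(x_1), h_k(x_1, x_2), …, h_k(x_1, …, x_n)` and the
elementary symmetric polynomials `e_r(x_1, …, x_n)` with `n - k + 1 ≤ r ≤ n`. -/
noncomputable def idealJ (F : Type*) [Field F] (n k : ℕ) : Ideal (MvPolynomial (Fin n) F) :=
  Ideal.span
    (Set.range (fun i : Fin n => partialHsymm F k i) ∪
      (fun r => esymm (Fin n) F r) '' {r : ℕ | n + 1 ≤ r + k ∧ r ≤ n})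

/-- The quotient ring `S_{n,k} = F[x_1, …, x_n] / J_{n,k}`. -/
abbrev QuotientS (F : Type*) [Field F] (n k : ℕ) : Type _ :=
  MvPolynomial (Fin n) F ⧸ idealJ F n k

/-- The initial ideal of `I`: generated by the leading terms of the nonzero elements of `I`. -/
noncomputable def initialIdeal {σ F : Type*} [Field F] (m : MonomialOrder σ)
    (I : Ideal (MvPolynomial σ F)) : Ideal (MvPolynomial σ F) :=
  Ideal.span {g | ∃ f ∈ I, f ≠ 0 ∧ g = m.leadingTerm f}

/-- The standard monomials of `I`: the monomials that are not in the initial ideal. -/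
def standardMonomials {σ F : Type*} [Field F] (m : MonomialOrder σ)
    (I : Ideal (MvPolynomial σ F)) : Set (σ →₀ ℕ) :=
  {d | monomial d (1 : F) ∉ initialIdeal m I}

/-- The exponent vector of the skip monomial `x(S) = x_{s_1}^{s_1} x_{s_2}^{s_2-1} ⋯ x_{s_m}^{s_m-m+1}`
for `S = {s_1 < ⋯ < s_m}`.  The exponent at `s_j` is `s_j - (j - 1)`, where `j - 1` is the number
of elements of `S` below `s_j`; in the 0-based numbering the number `s_j` is `i + 1`.
(The subtraction never truncates.) -/
noncomputable def skipExponent {n : ℕ} (S : Finset (Fin n)) : Fin n →₀ ℕ :=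
  Finsupp.equivFunOnFinite.symm fun i =>
    if i ∈ S then ((i : ℕ) + 1) - (S.filter (fun t => t < i)).card else 0

/-- The exponent vector of the reverse skip monomial `x(S)^*`, obtained from `x(S)` by replacing
each variable `x_s` by `x_{n-s+1}`. -/
noncomputable def reverseSkipExponent {n : ℕ} (S : Finset (Fin n)) : Fin n →₀ ℕ :=
  Finsupp.equivFunOnFinite.symm fun i => skipExponent S (Fin.rev i)

/-- The set `C_{n,k}` of `(n,k)`-reverse nonskip monomials: those divisible by no `x_i^k` and by no
reverse skip monomial `x(S)^*` with `|S| = n - k + 1`. -/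
def reverseNonskip (n k : ℕ) : Set (Fin n →₀ ℕ) :=
  {d | (∀ i : Fin n, ¬ Finsupp.single i k ≤ d) ∧
    ∀ S : Finset (Fin n), S.card + k = n + 1 → ¬ reverseSkipExponent S ≤ d}

/-- Ordered set partitions `(B_1 | ⋯ | B_k)` of an `n`-element set into `k` nonempty blocks. -/
def OrderedSetPartition (n k : ℕ) : Type :=
  {B : Fin k → Finset (Fin n) //
    (∀ i, (B i).Nonempty) ∧ (∀ i j, i ≠ j → Disjoint (B i) (B j)) ∧ ∀ x, ∃ i, x ∈ B i}

/-! The proof is a squeeze. The standard monomials lie in $\mathcal{C}_{n,k}$; the size of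
$\mathcal{C}_{n,k}$ is at most the number of surjections from an $n$-set to a $k$-set; and that
number is at most the number of standard monomials. Hence the inclusion is an equality. Standard
monomials always give a basis of the quotient (Macaulay), and surjections are ordered set
partitions.

Inclusion. $x_i^k$ is the leading monomial of $h_k(x_1,\dots,x_i)$. To realize a reverse skip
monomial with support $T$, the variables are added one at a time, using Hankel minors
$\det(e_{q+a+c_b}(x_1,\dots,x_j))_{a,b}$. By
$e_z(x_1,\dots,x_{j+1})=e_z(x_1,\dots,x_j)+x_{j+1}e_{z-1}(x_1,\dots,x_j)$, passing a variable of $T$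
multiplies the leading monomial by that variable to the power of the size of the minors, and passing
a variable outside $T$ rewrites the same polynomial through minors one size smaller. At the end the
minors are single entries $e_r$ with $r\ge n-k+1$, which lie in $J_{n,k}$ (`exists_minorSpan_lead`).

Upper bound. A counter run along an exponent vector either reaches $k$ or exposes a reverse skip
monomial dividing it (`exists_finset_of_not_counterReaches`). The vectors in $\{0,\dots,k-1\}^n$ on
which it succeeds satisfy the same recurrence as surjections (`sum_counterReaches_eq`).

Lower bound. Over an infinite extension field each surjection is encoded by a point, so that every
generator of $J_{n,k}$ is the top form of a polynomial vanishing at all the points. Monomials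
spanning modulo $J_{n,k}$ then span all functions on the points, so there are at least as many of
them as surjections. -/

/-! ### Standard monomials form a basis of the quotient. -/

section Macaulay

variable {σ F : Type*} [Field F] {m : MonomialOrder σ} {I : Ideal (MvPolynomial σ F)}

/-- A multiple of the largest exponent of an element of `I` lies in the initial ideal. -/
theorem monomial_mem_initialIdeal {f : MvPolynomial σ F} (hf : f ∈ I) {d e : σ →₀ ℕ}
    (hd : f.coeff d ≠ 0) (hmax : ∀ c ∈ f.support, c ≼[m] d) (hde : d ≤ e) :
    monomial e (1 : F) ∈ initialIdeal m I := by
  have hf0 : f ≠ 0 := fun h => hd (by simp [h])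
  have hdeg : m.degree f = d :=
    m.toSyn.injective (le_antisymm (m.degree_le_iff.2 hmax) (m.le_degree (mem_support_iff.2 hd)))
  have hlt : m.leadingTerm f ∈ initialIdeal m I := Ideal.subset_span ⟨f, hf, hf0, rfl⟩
  have hc : m.leadingCoeff f ≠ 0 := m.leadingCoeff_ne_zero_iff.2 hf0
  have : monomial e (1 : F) = monomial (e - d) (m.leadingCoeff f)⁻¹ * m.leadingTerm f := by
    rw [MonomialOrder.leadingTerm, monomial_mul, inv_mul_cancel₀ hc, hdeg, tsub_add_cancel_of_le hde]
  rw [this]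
  exact Ideal.mul_mem_left _ _ hlt

/-- A monomial in the initial ideal of `I` is a multiple of a leading monomial of `I`. -/
theorem exists_degree_le_of_monomial_mem_initialIdeal {d : σ →₀ ℕ}
    (hd : monomial d (1 : F) ∈ initialIdeal m I) :
    ∃ f ∈ I, f ≠ 0 ∧ m.degree f ≤ d := by
  have hle : initialIdeal m I ≤
      Ideal.span ((fun s => monomial s (1 : F)) '' {e | ∃ f ∈ I, f ≠ 0 ∧ m.degree f = e}) := by
    refine Ideal.span_le.2 ?_
    rintro _ ⟨f, hf, hf0, rfl⟩
    have : m.leadingTerm f = C (m.leadingCoeff f) * monomial (m.degree f) (1 : F) := by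
      rw [MonomialOrder.leadingTerm, C_mul_monomial, mul_one]
    rw [this]
    exact Ideal.mul_mem_left _ _ (Ideal.subset_span ⟨_, ⟨f, hf, hf0, rfl⟩, rfl⟩)
  have h := (mem_ideal_span_monomial_image.1 (hle hd)) d (by classical simp [coeff_monomial])
  obtain ⟨_, ⟨f, hf, hf0, rfl⟩, hle⟩ := h
  exact ⟨f, hf, hf0, hle⟩

/-- A nonzero element of `I` has a nonstandard monomial in its support. -/
theorem eq_zero_of_support_subset_standardMonomials {f : MvPolynomial σ F} (hf : f ∈ I)
    (hs : ∀ c ∈ f.support, c ∈ standardMonomials m I) : f = 0 := by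
  by_contra hf0
  refine hs _ (m.degree_mem_support hf0) ?_
  exact monomial_mem_initialIdeal hf (m.coeff_degree_ne_zero_iff.2 hf0)
    (fun c hc => m.le_degree hc) le_rfl

theorem linearIndependent_standardMonomials :
    LinearIndependent F (fun d : standardMonomials m I =>
      (Ideal.Quotient.mk I (monomial (d : σ →₀ ℕ) (1 : F)) : MvPolynomial σ F ⧸ I)) := by
  classical
  rw [linearIndependent_iff]
  intro l hl
  have hmk : ∀ l : standardMonomials m I →₀ F,
      Finsupp.linearCombination F (fun d : standardMonomials m I =>
        (Ideal.Quotient.mk I (monomial (d : σ →₀ ℕ) (1 : F)) : MvPolynomial σ F ⧸ I)) l =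
      Ideal.Quotient.mk I (Finsupp.linearCombination F (fun d : standardMonomials m I =>
        (monomial (d : σ →₀ ℕ) (1 : F))) l) := by
    intro l
    have := Finsupp.apply_linearCombination F (Ideal.Quotient.mkₐ F I).toLinearMap
      (fun d : standardMonomials m I => (monomial (d : σ →₀ ℕ) (1 : F))) l
    exact this.symm
  rw [hmk, Ideal.Quotient.eq_zero_iff_mem] at hl
  have h0 := eq_zero_of_support_subset_standardMonomials hl (m := m) ?_
  · have hli : LinearIndependent F (fun d : standardMonomials m I =>
        (monomial (d : σ →₀ ℕ) (1 : F))) := by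
      have := (basisMonomials σ F).linearIndependent.comp
        (fun d : standardMonomials m I => (d : σ →₀ ℕ)) Subtype.val_injective
      simpa [Function.comp_def] using this
    exact (linearIndependent_iff.1 hli) l h0
  · intro c hc
    by_contra hcs
    rw [mem_support_iff] at hc
    apply hc
    rw [Finsupp.linearCombination_apply, Finsupp.sum, coeff_sum]
    refine Finset.sum_eq_zero fun d _ => ?_
    rw [coeff_smul, coeff_monomial, if_neg, smul_zero]
    rintro rfl
    exact hcs d.2

/-- Every polynomial is congruent modulo `I` to a combination of standard monomials. -/
theorem span_standardMonomials_sup :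
    Submodule.span F ((fun d => monomial d (1 : F)) '' standardMonomials m I) ⊔
      I.restrictScalars F = ⊤ := by
  set N := Submodule.span F ((fun d => monomial d (1 : F)) '' standardMonomials m I) ⊔
      I.restrictScalars F with hN
  have key : ∀ s : m.syn, ∀ d : σ →₀ ℕ, m.toSyn d = s → monomial d (1 : F) ∈ N := by
    classical
    intro s
    induction s using WellFoundedLT.induction with
    | ind s ih =>
      rintro d rfl
      by_cases hd : d ∈ standardMonomials m I
      · exact Submodule.mem_sup_left (Submodule.subset_span ⟨d, hd, rfl⟩)
      · obtain ⟨f, hf, hf0, hle⟩ := exists_degree_le_of_monomial_mem_initialIdeal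
          (not_not.1 (show ¬ ¬ _ from hd))
        have hc : m.leadingCoeff f ≠ 0 := m.leadingCoeff_ne_zero_iff.2 hf0
        -- A multiple of `f` with leading monomial `d` and leading coefficient 1; subtracting it
        -- replaces `d` by smaller monomials.
        set g := monomial (d - m.degree f) (m.leadingCoeff f)⁻¹ * f with hg
        have hgI : g ∈ I := Ideal.mul_mem_left _ _ hf
        have hgd : g.coeff d = 1 := by
          have hd' : d = (d - m.degree f) + m.degree f := (tsub_add_cancel_of_le hle).symm
          conv_lhs => rw [hg, hd', add_tsub_cancel_right]
          rw [coeff_monomial_mul, ← MonomialOrder.leadingCoeff, inv_mul_cancel₀ hc]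
        have hgs : ∀ c ∈ g.support, c ≼[m] d := by
          have h1 : m.toSyn (m.degree g) ≤ m.toSyn d := by
            refine (m.degree_mul_le).trans ?_
            rw [map_add]
            refine (add_le_add_left (m.degree_monomial_le _) _).trans ?_
            rw [← map_add, tsub_add_cancel_of_le hle]
          exact fun c hc => (m.le_degree hc).trans h1
        have hrest : g - monomial d (1 : F) ∈ N := by
          rw [(g - monomial d (1 : F)).as_sum]
          refine Submodule.sum_mem _ fun c hc => ?_
          rw [mem_support_iff, coeff_sub, coeff_monomial] at hc
          have hcd : c ≠ d := by
            rintro rfl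
            simp [hgd] at hc
          rw [if_neg (Ne.symm hcd), sub_zero] at hc
          have hlt : m.toSyn c < m.toSyn d :=
            lt_of_le_of_ne (hgs c (mem_support_iff.2 hc)) (fun h => hcd (m.toSyn.injective h))
          have := N.smul_mem ((g - monomial d (1 : F)).coeff c) (ih _ hlt c rfl)
          rwa [smul_monomial, smul_eq_mul, mul_one] at this
        have := N.sub_mem (show g ∈ N from Submodule.mem_sup_right hgI) hrest
        rwa [sub_sub_cancel] at this
  rw [eq_top_iff]
  rintro p -
  rw [p.as_sum]
  refine Submodule.sum_mem _ fun c _ => ?_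
  have := N.smul_mem (p.coeff c) (key _ c rfl)
  rwa [smul_monomial, smul_eq_mul, mul_one] at this

theorem span_mk_standardMonomials :
    Submodule.span F (Set.range (fun d : standardMonomials m I =>
      (Ideal.Quotient.mk I (monomial (d : σ →₀ ℕ) (1 : F)) : MvPolynomial σ F ⧸ I))) = ⊤ := by
  rw [eq_top_iff]
  rintro x -
  obtain ⟨p, rfl⟩ := Ideal.Quotient.mk_surjective x
  have hp : p ∈ Submodule.span F ((fun d => monomial d (1 : F)) '' standardMonomials m I) ⊔
      I.restrictScalars F := by rw [span_standardMonomials_sup]; trivial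
  obtain ⟨a, ha, b, hb, rfl⟩ := Submodule.mem_sup.1 hp
  rw [map_add, Ideal.Quotient.eq_zero_iff_mem.2 hb, add_zero]
  have := Submodule.mem_map_of_mem (f := (Ideal.Quotient.mkₐ F I).toLinearMap) ha
  rw [Submodule.map_span, ← Set.image_comp] at this
  rw [← Set.image_eq_range (f := fun d : σ →₀ ℕ => (Ideal.Quotient.mk I (monomial d (1 : F))))]
  exact this

end Macaulay

/-! ### Elementary symmetric functions of initial segments and their Hankel minors. -/

section PartialEsymm

variable {R : Type*} [CommRing R]

/-- The elementary symmetric function of degree `z` in `x 0, …, x (j - 1)`, which is zero when `z`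
is negative. -/
def partialEsymm (x : ℕ → R) : ℕ → ℤ → R
  | 0, z => if z = 0 then 1 else 0
  | j + 1, z => partialEsymm x j z + x j * partialEsymm x j (z - 1)

theorem partialEsymm_of_neg (x : ℕ → R) (j : ℕ) {z : ℤ} (hz : z < 0) : partialEsymm x j z = 0 := by
  induction j generalizing z with
  | zero => simp [partialEsymm, hz.ne]
  | succ j ih => rw [partialEsymm, ih hz, ih (by omega), mul_zero, add_zero]

theorem partialEsymm_natCast (x : ℕ → R) (j r : ℕ) :
    partialEsymm x j r = ((Multiset.range j).map x).esymm r := by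
  induction j generalizing r with
  | zero =>
    cases r with
    | zero => simp [partialEsymm, Multiset.esymm]
    | succ r =>
      have : ((r : ℤ) + 1) ≠ 0 := by omega
      simp [partialEsymm, Multiset.esymm, this, Multiset.powersetCard_zero_right]
  | succ j ih =>
    rw [partialEsymm, ih, Multiset.range_succ, Multiset.map_cons]
    cases r with
    | zero =>
      rw [partialEsymm_of_neg _ _ (by simp)]
      simp [Multiset.esymm]
    | succ r =>
      have : ((r + 1 : ℕ) : ℤ) - 1 = (r : ℕ) := by push_cast; ring
      rw [this, ih]
      simp only [Multiset.esymm, Multiset.powersetCard_cons, Multiset.map_add, Multiset.sum_add,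
        Multiset.map_map, Function.comp_def, Multiset.prod_cons, Multiset.sum_map_mul_left]

/-- The minor of the Hankel matrix of the partial elementary symmetric functions given by the
consecutive rows `q, …, q + t` and by the columns `c`. -/
def hankelMinor (x : ℕ → R) (j : ℕ) (q : ℤ) (t : ℕ) (c : Fin (t + 1) → ℕ) : R :=
  (Matrix.of fun i l : Fin (t + 1) => partialEsymm x j (q + (i : ℕ) + c l)).det

/-- Adding `x j` times the preceding row to every row but the top one turns $e_z$ of $j$ variables
into $e_z$ of $j+1$ variables. Expanding along the untouched top row leaves minors one size smaller.
-/
theorem hankelMinor_sub_one (x : ℕ → R) (j : ℕ) (q : ℤ) (t : ℕ) (c : Fin (t + 2) → ℕ) :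
    hankelMinor x j (q - 1) (t + 1) c =
      ∑ l : Fin (t + 2), (-1) ^ (l : ℕ) * partialEsymm x j (q - 1 + c l) *
        hankelMinor x (j + 1) q t (c ∘ l.succAbove) := by
  let B : Matrix (Fin (t + 2)) (Fin (t + 2)) R := fun i l =>
    Fin.cases (partialEsymm x j (q - 1 + c l))
      (fun i' : Fin (t + 1) => partialEsymm x (j + 1) (q + (i' : ℕ) + c l)) i
  have hdet : hankelMinor x j (q - 1) (t + 1) c = B.det := by
    refine Matrix.det_eq_of_forall_row_eq_smul_add_pred (fun _ => -x j) ?_ ?_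
    · intro l
      simp [B]
    · intro i l
      simp only [Matrix.of_apply, B, Fin.cases_succ, partialEsymm, Fin.val_succ, Fin.val_castSucc]
      have h1 : q - 1 + ((i : ℕ) + 1 : ℕ) + c l = q + (i : ℕ) + c l := by push_cast; ring
      have h2 : q - 1 + (i : ℕ) + c l = q + (i : ℕ) + c l - 1 := by ring
      rw [h1, h2]
      ring
  rw [hdet, Matrix.det_succ_row_zero]
  rfl

end PartialEsymm

/-! ### Bookkeeping of supports: which variables occur, and the degree in the last one. -/

section Support

variable {F : Type*} [Field F] {n : ℕ}

/-- Exponents of monomials in the variables of index less than `j`. -/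
def belowExponents (n j : ℕ) : Set (Fin n →₀ ℕ) := {c | ∀ i : Fin n, j ≤ i → c i = 0}

/-- Exponents of monomials in the variables of index at most `j` whose degree in the `j`-th variable
is less than `m`. -/
def lowExponents (n j m : ℕ) : Set (Fin n →₀ ℕ) :=
  {c | ∀ i : Fin n, ((i : ℕ) = j → c i < m) ∧ (j < (i : ℕ) → c i = 0)}

theorem mul_mem_restrictSupport {σ : Type*} {s t u : Set (σ →₀ ℕ)} {p q : MvPolynomial σ F}
    (hp : p ∈ restrictSupport F s) (hq : q ∈ restrictSupport F t)
    (h : ∀ a ∈ s, ∀ b ∈ t, a + b ∈ u) : p * q ∈ restrictSupport F u := by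
  classical
  rw [mem_restrictSupport_iff] at *
  intro c hc
  obtain ⟨a, ha, b, hb, rfl⟩ := Finset.mem_add.1 (support_mul p q hc)
  exact h a (hp ha) b (hq hb)

theorem one_mem_restrictSupport_below (j : ℕ) :
    (1 : MvPolynomial (Fin n) F) ∈ restrictSupport F (belowExponents n j) := by
  rw [← C_1, ← monomial_zero', monomial_mem_restrictSupport]
  exact Or.inl fun i _ => rfl

theorem mul_mem_restrictSupport_below {j : ℕ} {p q : MvPolynomial (Fin n) F}
    (hp : p ∈ restrictSupport F (belowExponents n j))
    (hq : q ∈ restrictSupport F (belowExponents n j)) :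
    p * q ∈ restrictSupport F (belowExponents n j) :=
  mul_mem_restrictSupport hp hq fun a ha b hb i hi => by simp [ha i hi, hb i hi]

theorem mul_mem_restrictSupport_low {j m : ℕ} {p q : MvPolynomial (Fin n) F}
    (hp : p ∈ restrictSupport F (belowExponents n j))
    (hq : q ∈ restrictSupport F (lowExponents n j m)) :
    p * q ∈ restrictSupport F (lowExponents n j m) :=
  mul_mem_restrictSupport hp hq fun a ha b hb i =>
    ⟨fun hi => by simpa [ha i hi.ge] using (hb i).1 hi,
     fun hi => by simp [ha i hi.le, (hb i).2 hi]⟩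

/-- The `l`-th variable, or zero if there is none. -/
noncomputable def variableSeq (F : Type*) [Field F] (n l : ℕ) : MvPolynomial (Fin n) F :=
  if h : l < n then X ⟨l, h⟩ else 0

theorem variableSeq_mul_mem_low {j m : ℕ} {p : MvPolynomial (Fin n) F}
    (hp : p ∈ restrictSupport F (lowExponents n j m)) :
    variableSeq F n j * p ∈ restrictSupport F (lowExponents n j (m + 1)) := by
  unfold variableSeq
  split_ifs with h
  · refine mul_mem_restrictSupport (s := {Finsupp.single ⟨j, h⟩ 1}) ?_ hp ?_
    · rw [X, monomial_mem_restrictSupport]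
      exact Or.inl rfl
    · rintro _ rfl b hb i
      refine ⟨fun hi => ?_, fun hi => ?_⟩
      · have := (hb i).1 hi
        have hi' : i = ⟨j, h⟩ := Fin.ext hi
        subst hi'
        simp
        omega
      · have hne : (⟨j, h⟩ : Fin n) ≠ i := fun e => by rw [← e] at hi; simp at hi
        simp [(hb i).2 hi, hne.symm]
  · rw [zero_mul]
    exact Submodule.zero_mem _

theorem variableSeq_pow_mul_mem_low {j m : ℕ} {p : MvPolynomial (Fin n) F}
    (hp : p ∈ restrictSupport F (belowExponents n j)) :
    variableSeq F n j ^ m * p ∈ restrictSupport F (lowExponents n j (m + 1)) := by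
  induction m with
  | zero =>
    rw [pow_zero, one_mul]
    refine restrictSupport_mono F (fun c hc i => ⟨fun hi => ?_, fun hi => hc i hi.le⟩) hp
    simp [hc i hi.ge]
  | succ m ih =>
    rw [pow_succ', mul_assoc]
    exact variableSeq_mul_mem_low ih

theorem below_le_below_succ (j : ℕ) :
    restrictSupport F (belowExponents n j) ≤ restrictSupport F (belowExponents n (j + 1)) :=
  restrictSupport_mono F fun _ hc i hi => hc i (by omega)

theorem low_le_below_succ (j m : ℕ) :
    restrictSupport F (lowExponents n j m) ≤ restrictSupport F (belowExponents n (j + 1)) :=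
  restrictSupport_mono F fun _ hc i hi => (hc i).2 hi

theorem low_le_low_succ (j m : ℕ) :
    restrictSupport F (lowExponents n j m) ≤ restrictSupport F (lowExponents n j (m + 1)) :=
  restrictSupport_mono F fun _ hc i => ⟨fun hi => ((hc i).1 hi).trans (Nat.lt_succ_self _), (hc i).2⟩

theorem partialEsymm_mem_below (j : ℕ) (z : ℤ) :
    partialEsymm (variableSeq F n) j z ∈ restrictSupport F (belowExponents n j) := by
  induction j generalizing z with
  | zero =>
    unfold partialEsymm
    split_ifs
    · exact one_mem_restrictSupport_below 0
    · exact Submodule.zero_mem _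
  | succ j ih =>
    refine Submodule.add_mem _ (below_le_below_succ j (ih z)) (low_le_below_succ j 2 ?_)
    simpa using variableSeq_pow_mul_mem_low (m := 1) (ih (z - 1))

theorem prod_mem_below {ι : Type*} (s : Finset ι) {j : ℕ} {a : ι → MvPolynomial (Fin n) F}
    (ha : ∀ i, a i ∈ restrictSupport F (belowExponents n j)) :
    ∏ i ∈ s, a i ∈ restrictSupport F (belowExponents n j) := by
  classical
  induction s using Finset.induction_on with
  | empty => simpa using one_mem_restrictSupport_below j
  | insert i s hi ih =>
    rw [Finset.prod_insert hi]
    exact mul_mem_restrictSupport_below (ha i) ih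

/-- Full degree in the $j$-th variable is attained only by taking the term with `a i` from every
factor; all other terms of the expansion have smaller degree. -/
theorem prod_sub_mem_low {ι : Type*} (s : Finset ι) {j : ℕ} {a b : ι → MvPolynomial (Fin n) F}
    (ha : ∀ i, a i ∈ restrictSupport F (belowExponents n j))
    (hb : ∀ i, b i ∈ restrictSupport F (belowExponents n j)) :
    ∏ i ∈ s, (b i + variableSeq F n j * a i) - variableSeq F n j ^ s.card * ∏ i ∈ s, a i ∈
      restrictSupport F (lowExponents n j s.card) := by
  classical
  induction s using Finset.induction_on with
  | empty => simp
  | insert i s hi ih =>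
    rw [Finset.prod_insert hi, Finset.prod_insert hi, Finset.card_insert_of_notMem hi]
    set y := variableSeq F n j
    set P := ∏ i ∈ s, (b i + y * a i)
    set Q := ∏ i ∈ s, a i with hQ
    have : (b i + y * a i) * P - y ^ (s.card + 1) * (a i * Q) =
        y * (a i * (P - y ^ s.card * Q)) + y ^ s.card * (b i * Q) +
          b i * (P - y ^ s.card * Q) := by ring
    rw [this]
    refine Submodule.add_mem _ (Submodule.add_mem _ ?_ ?_) ?_
    · exact variableSeq_mul_mem_low (mul_mem_restrictSupport_low (ha i) ih)
    · exact variableSeq_pow_mul_mem_low (mul_mem_restrictSupport_below (hb i) (prod_mem_below s ha))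
    · exact low_le_low_succ _ _ (mul_mem_restrictSupport_low (hb i) ih)

theorem det_mem_below {ι : Type*} [Fintype ι] [DecidableEq ι] {j : ℕ}
    {A : Matrix ι ι (MvPolynomial (Fin n) F)}
    (hA : ∀ i l, A i l ∈ restrictSupport F (belowExponents n j)) :
    A.det ∈ restrictSupport F (belowExponents n j) := by
  rw [Matrix.det_apply]
  refine Submodule.sum_mem _ fun σ _ => ?_
  rw [Units.smul_def]
  exact zsmul_mem (prod_mem_below _ fun i => hA _ _) _

theorem det_sub_mem_low {ι : Type*} [Fintype ι] [DecidableEq ι] {j : ℕ}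
    {A B : Matrix ι ι (MvPolynomial (Fin n) F)}
    (hA : ∀ i l, A i l ∈ restrictSupport F (belowExponents n j))
    (hB : ∀ i l, B i l ∈ restrictSupport F (belowExponents n j)) :
    (Matrix.of fun i l => B i l + variableSeq F n j * A i l).det -
      variableSeq F n j ^ Fintype.card ι * A.det ∈
        restrictSupport F (lowExponents n j (Fintype.card ι)) := by
  rw [Matrix.det_apply, Matrix.det_apply, Finset.mul_sum, ← Finset.sum_sub_distrib]
  refine Submodule.sum_mem _ fun σ _ => ?_
  rw [mul_smul_comm, ← smul_sub, Units.smul_def]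
  exact zsmul_mem (prod_sub_mem_low (a := fun i => A (σ i) i) (b := fun i => B (σ i) i)
    Finset.univ (fun i => hA _ _) fun i => hB _ _) _

end Support

/-! ### How spans of Hankel minors change when a variable is added. -/

section Minors

variable (F : Type*) [Field F] (n : ℕ)

/-- Combinations of Hankel minors with coefficients in the variables of index less than `j`. -/
noncomputable def minorSpan (j : ℕ) (q : ℤ) (t : ℕ) : Submodule F (MvPolynomial (Fin n) F) :=
  Submodule.span F {g | ∃ a ∈ restrictSupport F (belowExponents n j), ∃ c : Fin (t + 1) → ℕ,
    g = a * hankelMinor (variableSeq F n) j q t c}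

variable {F n}

theorem minorSpan_le_below (j : ℕ) (q : ℤ) (t : ℕ) :
    minorSpan F n j q t ≤ restrictSupport F (belowExponents n j) := by
  refine Submodule.span_le.2 ?_
  rintro _ ⟨a, ha, c, rfl⟩
  exact mul_mem_restrictSupport_below ha (det_mem_below fun i l => partialEsymm_mem_below _ _)

/-- The step for a variable outside $T$: the polynomial stays the same and only its description
changes. -/
theorem minorSpan_sub_one_le (j : ℕ) (q : ℤ) (t : ℕ) :
    minorSpan F n j (q - 1) (t + 1) ≤ minorSpan F n (j + 1) q t := by
  refine Submodule.span_le.2 ?_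
  rintro _ ⟨a, ha, c, rfl⟩
  rw [hankelMinor_sub_one, Finset.mul_sum]
  refine Submodule.sum_mem _ fun l _ => ?_
  rw [mul_assoc, ← mul_assoc, mul_comm a, mul_assoc]
  have h : ((-1 : MvPolynomial (Fin n) F) ^ (l : ℕ)) = C ((-1) ^ (l : ℕ)) := by simp
  rw [h, ← smul_eq_C_mul]
  refine Submodule.smul_mem _ _ (Submodule.subset_span ⟨_, ?_, c ∘ l.succAbove, (mul_assoc _ _ _).symm⟩)
  exact below_le_below_succ j (mul_mem_restrictSupport_below ha (partialEsymm_mem_below _ _))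

/-- The step for a variable of $T$. Each entry in $j+1$ variables is an entry in $j$ variables plus
`variableSeq F n j` times the entry of index one lower. So the minor starting at `q` has top
coefficient, in that variable, equal to the minor starting at `q - 1`. -/
theorem exists_minorSpan_sub_mem_low {j : ℕ} {q : ℤ} {t : ℕ} {f : MvPolynomial (Fin n) F}
    (hf : f ∈ minorSpan F n j (q - 1) t) :
    ∃ g ∈ minorSpan F n (j + 1) q t,
      g - variableSeq F n j ^ (t + 1) * f ∈ restrictSupport F (lowExponents n j (t + 1)) := by
  induction hf using Submodule.span_induction with
  | mem f hf =>
    obtain ⟨a, ha, c, rfl⟩ := hf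
    refine ⟨a * hankelMinor (variableSeq F n) (j + 1) q t c,
      Submodule.subset_span ⟨a, below_le_below_succ j ha, c, rfl⟩, ?_⟩
    have h := det_sub_mem_low (F := F) (n := n) (j := j)
      (A := Matrix.of fun i l : Fin (t + 1) =>
        partialEsymm (variableSeq F n) j (q - 1 + (i : ℕ) + c l))
      (B := Matrix.of fun i l : Fin (t + 1) =>
        partialEsymm (variableSeq F n) j (q + (i : ℕ) + c l))
      (fun i l => partialEsymm_mem_below _ _) (fun i l => partialEsymm_mem_below _ _)
    rw [Fintype.card_fin] at h
    have h2 := mul_mem_restrictSupport_low ha h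
    have h3 : (Matrix.of fun i l : Fin (t + 1) =>
        (Matrix.of fun i l : Fin (t + 1) =>
          partialEsymm (variableSeq F n) j (q + (i : ℕ) + c l)) i l + variableSeq F n j *
        (Matrix.of fun i l : Fin (t + 1) =>
          partialEsymm (variableSeq F n) j (q - 1 + (i : ℕ) + c l)) i l).det =
        hankelMinor (variableSeq F n) (j + 1) q t c := by
      unfold hankelMinor
      congr 1
      ext1 i l
      simp only [Matrix.of_apply, partialEsymm]
      congr 3
      ring
    rw [h3] at h2
    convert h2 using 1
    unfold hankelMinor
    ring
  | zero => exact ⟨0, Submodule.zero_mem _, by simp⟩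
  | add f₁ f₂ _ _ h₁ h₂ =>
    obtain ⟨g₁, hg₁, h₁⟩ := h₁
    obtain ⟨g₂, hg₂, h₂⟩ := h₂
    refine ⟨g₁ + g₂, Submodule.add_mem _ hg₁ hg₂, ?_⟩
    convert Submodule.add_mem _ h₁ h₂ using 1
    ring
  | smul r f _ h =>
    obtain ⟨g, hg, h⟩ := h
    refine ⟨r • g, Submodule.smul_mem _ _ hg, ?_⟩
    convert Submodule.smul_mem _ r h using 1
    rw [smul_sub, mul_smul_comm]

theorem one_mem_minorSpan_zero (t : ℕ) : (1 : MvPolynomial (Fin n) F) ∈ minorSpan F n 0 (-t) t := by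
  refine Submodule.subset_span
    -- With these columns the entry at `(i, l)` is $e_{i-l}$ of no variables, so the matrix is the
    -- identity; `t - l` does not truncate because `l ≤ t`.
    ⟨1, one_mem_restrictSupport_below 0, fun l => t - l, ?_⟩
  have : (Matrix.of fun i l : Fin (t + 1) =>
      partialEsymm (variableSeq F n) 0 (-(t : ℤ) + (i : ℕ) + ((t - l : ℕ) : ℤ))) = 1 := by
    ext1 i l
    rw [Matrix.of_apply, partialEsymm, Matrix.one_apply]
    congr 1
    rw [Fin.ext_iff, eq_iff_iff]
    omega
  rw [one_mul, hankelMinor, this, Matrix.det_one]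

end Minors

/-! ### Reverse skip exponents rewritten in terms of the reversed set. -/

section GapExponent

variable {n : ℕ}

/-- The exponent vector which is `1 + #{l > i | l ∉ T}` at the elements `i` of `T`. -/
noncomputable def gapExponent (T : Finset (Fin n)) : Fin n →₀ ℕ :=
  Finsupp.equivFunOnFinite.symm fun i =>
    if i ∈ T then 1 + (Finset.univ.filter fun l => i < l ∧ l ∉ T).card else 0

theorem gapExponent_apply (T : Finset (Fin n)) (i : Fin n) :
    gapExponent T i = if i ∈ T then 1 + (Finset.univ.filter fun l => i < l ∧ l ∉ T).card else 0 :=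
  rfl

theorem reverseSkipExponent_map_rev (T : Finset (Fin n)) :
    reverseSkipExponent (T.map Fin.revPerm.toEmbedding) = gapExponent T := by
  ext i
  change (if Fin.rev i ∈ _ then _ else _) = if _ then _ else _
  have hmem : ∀ l : Fin n, Fin.rev l ∈ T.map Fin.revPerm.toEmbedding ↔ l ∈ T := by
    intro l
    simp
  simp only [hmem]
  split_ifs with hi
  · have h1 : ((T.map Fin.revPerm.toEmbedding).filter fun t => t < Fin.rev i).card =
        (T.filter fun l => i < l).card := by
      rw [Finset.filter_map, Finset.card_map]
      congr 1
      ext l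
      simp
    -- The indices above `i` split into members and nonmembers of `T`, which turns the subtraction
    -- in `skipExponent` into a count of gaps.
    have h2 : (T.filter fun l => i < l).card +
        (Finset.univ.filter fun l => i < l ∧ l ∉ T).card = n - 1 - i := by
      rw [← Fin.card_Ioi, ← Finset.card_union_of_disjoint]
      · congr 1
        ext l
        simp only [Finset.mem_union, Finset.mem_filter, Finset.mem_univ, true_and, Finset.mem_Ioi]
        tauto
      · rw [Finset.disjoint_left]
        intro l
        simp only [Finset.mem_filter, Finset.mem_univ, true_and]
        tauto
    rw [h1, Fin.val_rev]
    change n - (i + 1 : ℕ) + 1 - (T.filter fun l => i < l).card =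
      1 + (Finset.univ.filter fun l => i < l ∧ l ∉ T).card
    have h3 := i.2
    omega
  · rfl

theorem exists_eq_map_rev (S : Finset (Fin n)) :
    ∃ T : Finset (Fin n), T.card = S.card ∧ reverseSkipExponent S = gapExponent T := by
  refine ⟨S.map Fin.revPerm.toEmbedding, Finset.card_map _, ?_⟩
  rw [← reverseSkipExponent_map_rev, Finset.map_map]
  congr 1
  ext l
  simp

/-- The restriction of `gapExponent T` to the indices less than `j`. -/
noncomputable def gapExponentBelow (T : Finset (Fin n)) (j : ℕ) : Fin n →₀ ℕ :=
  Finsupp.equivFunOnFinite.symm fun i => if (i : ℕ) < j then gapExponent T i else 0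

theorem gapExponentBelow_apply (T : Finset (Fin n)) (j : ℕ) (i : Fin n) :
    gapExponentBelow T j i = if (i : ℕ) < j then gapExponent T i else 0 := rfl

theorem gapExponentBelow_self (T : Finset (Fin n)) : gapExponentBelow T n = gapExponent T := by
  ext i
  rw [gapExponentBelow_apply, if_pos i.2]

theorem gapExponentBelow_zero (T : Finset (Fin n)) : gapExponentBelow T 0 = 0 := by
  ext i
  simp [gapExponentBelow_apply]

theorem gapExponentBelow_succ (T : Finset (Fin n)) (i : Fin n) :
    gapExponentBelow T (i + 1) = gapExponentBelow T i + Finsupp.single i (gapExponent T i) := by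
  ext l
  rw [Finsupp.add_apply, gapExponentBelow_apply, gapExponentBelow_apply]
  by_cases hl : l = i
  · subst hl
    simp
  · rw [Finsupp.single_eq_of_ne hl, add_zero]
    have : (l : ℕ) ≠ i := fun h => hl (Fin.ext h)
    congr 1
    rw [eq_iff_iff]
    omega

end GapExponent

/-! ### Reverse skip monomials and $k$-th powers are leading monomials. -/

section LeadingMonomials

variable {F : Type*} [Field F] {n : ℕ}

/-- The minors have size one more than the number $t$ of later indices outside $T$, and start at
$q=|T\cap[0,j)|-t$. Passing an index raises $q$ by one in either case: inside $T$ the first term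
grows, outside $T$ the number $t$ drops. Inside $T$ the exponent gained is $t+1$, the value of
`gapExponent`. -/
theorem exists_minorSpan_lead (T : Finset (Fin n)) (j : ℕ) (hj : j ≤ n) :
    ∃ f ∈ minorSpan F n j ((T.filter fun i : Fin n => (i : ℕ) < j).card -
        (Finset.univ.filter fun l : Fin n => j ≤ (l : ℕ) ∧ l ∉ T).card : ℤ)
        (Finset.univ.filter fun l : Fin n => j ≤ (l : ℕ) ∧ l ∉ T).card,
      f.coeff (gapExponentBelow T j) = 1 ∧
        ∀ c ∈ f.support, c ≼[neglex n] gapExponentBelow T j := by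
  induction j with
  | zero =>
    refine ⟨1, ?_, ?_, ?_⟩
    · have h0 : (T.filter fun i : Fin n => (i : ℕ) < 0).card = 0 := by simp
      rw [h0, Nat.cast_zero, zero_sub]
      exact one_mem_minorSpan_zero _
    · simp [gapExponentBelow_zero]
    · intro c hc
      rw [gapExponentBelow_zero]
      have : c = 0 := by
        classical
        by_contra h
        rw [mem_support_iff, coeff_one, if_neg (Ne.symm h)] at hc
        exact hc rfl
      rw [this]
  | succ j ih =>
    obtain ⟨f, hf, hf1, hmax⟩ := ih (by omega)
    let i : Fin n := ⟨j, hj⟩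
    have hgap := gapExponentBelow_succ T i
    change gapExponentBelow T (j + 1) = gapExponentBelow T j + _ at hgap
    set p := (T.filter fun i : Fin n => (i : ℕ) < j).card with hp
    set t := (Finset.univ.filter fun l : Fin n => j ≤ (l : ℕ) ∧ l ∉ T).card with ht
    set p' := (T.filter fun i : Fin n => (i : ℕ) < j + 1).card with hp'
    set t' := (Finset.univ.filter fun l : Fin n => j + 1 ≤ (l : ℕ) ∧ l ∉ T).card with ht'
    by_cases hi : i ∈ T
    · have h1 : p' = p + 1 := by
        have : (T.filter fun l : Fin n => (l : ℕ) < j + 1) = insert i (T.filter fun l : Fin n => (l : ℕ) < j) := by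
          ext l
          simp only [Finset.mem_filter, Finset.mem_insert]
          constructor
          · rintro ⟨h, h'⟩
            by_cases hl : (l : ℕ) = j
            · exact Or.inl (Fin.ext hl)
            · exact Or.inr ⟨h, by omega⟩
          · rintro (rfl | ⟨h, h'⟩)
            · exact ⟨hi, Nat.lt_succ_self j⟩
            · exact ⟨h, by omega⟩
        rw [hp', this, Finset.card_insert_of_notMem (by simp [i])]
      have h2 : t' = t := by
        rw [ht, ht']
        congr 1
        ext l
        simp only [Finset.mem_filter, Finset.mem_univ, true_and]
        constructor
        · rintro ⟨h, h'⟩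
          exact ⟨by omega, h'⟩
        · rintro ⟨h, h'⟩
          refine ⟨?_, h'⟩
          by_contra hl
          exact h' ((show l = i from Fin.ext (by simp [i]; omega)) ▸ hi)
      have hgi : gapExponent T i = t + 1 := by
        rw [gapExponent_apply, if_pos hi, add_comm, ← h2, ht']
        rfl
      rw [h1, h2]
      have hq : (p : ℤ) - t = ((p + 1 : ℕ) : ℤ) - t - 1 := by push_cast; ring
      rw [hq] at hf
      obtain ⟨g, hg, hlow⟩ := exists_minorSpan_sub_mem_low hf
      have hfb := minorSpan_le_below _ _ _ hf
      rw [mem_restrictSupport_iff] at hlow hfb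
      have hx : variableSeq F n j ^ (t + 1) * f = monomial (Finsupp.single i (t + 1)) 1 * f := by
        rw [variableSeq, dif_pos (show j < n from hj), X_pow_eq_monomial]
      rw [hx] at hlow
      rw [hgi] at hgap
      set r := g - monomial (Finsupp.single i (t + 1)) 1 * f with hr
      have hgr : g = monomial (Finsupp.single i (t + 1)) 1 * f + r := by rw [hr]; ring
      refine ⟨g, hg, ?_, ?_⟩
      · rw [hgr, hgap, coeff_add, add_comm (gapExponentBelow T j), coeff_monomial_mul, hf1, one_mul]
        have : r.coeff (Finsupp.single i (t + 1) + gapExponentBelow T j) = 0 := by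
          by_contra hne
          have := ((hlow (mem_support_iff.2 hne)) i).1 rfl
          simp only [Finsupp.add_apply, Finsupp.single_eq_same] at this
          omega
        rw [this, add_zero]
      · intro c hc
        have : c ∈ (monomial (Finsupp.single i (t + 1)) (1 : F) * f).support ∨ c ∈ r.support := by
          classical
          rw [hgr] at hc
          exact Finset.mem_union.1 (support_add hc)
        rcases this with hc | hc
        · rw [mem_support_iff, coeff_monomial_mul'] at hc
          split_ifs at hc with hle
          · rw [one_mul] at hc
            have h := hmax _ (mem_support_iff.2 hc)
            rw [← tsub_add_cancel_of_le hle, hgap, map_add, map_add]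
            exact add_le_add_left h _
          · exact absurd rfl hc
        -- The remainder has degree at most `t` in the $j$-th variable, the largest one present, so
        -- neglex puts it below the main term.
        · refine le_of_lt ((neglex_lt_iff _ _).2 ⟨i, fun l hl => ?_, ?_⟩)
          · rw [((hlow hc) l).2 hl, gapExponentBelow_apply, if_neg]
            have : j < (l : ℕ) := hl
            omega
          · have := ((hlow hc) i).1 rfl
            rw [hgap, Finsupp.add_apply, Finsupp.single_eq_same]
            omega
    · have h1 : p' = p := by
        rw [hp, hp']
        congr 1
        ext l
        simp only [Finset.mem_filter]
        constructor
        · rintro ⟨h, h'⟩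
          refine ⟨h, ?_⟩
          by_contra hl
          exact hi ((show l = i from Fin.ext (by simp [i]; omega)) ▸ h)
        · rintro ⟨h, h'⟩
          exact ⟨h, by omega⟩
      have h2 : t = t' + 1 := by
        have : (Finset.univ.filter fun l : Fin n => j ≤ (l : ℕ) ∧ l ∉ T) =
            insert i (Finset.univ.filter fun l : Fin n => j + 1 ≤ (l : ℕ) ∧ l ∉ T) := by
          ext l
          simp only [Finset.mem_filter, Finset.mem_univ, true_and, Finset.mem_insert]
          constructor
          · rintro ⟨h, h'⟩
            by_cases hl : (l : ℕ) = j
            · exact Or.inl (Fin.ext hl)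
            · exact Or.inr ⟨by omega, h'⟩
          · rintro (rfl | ⟨h, h'⟩)
            · exact ⟨le_rfl, hi⟩
            · exact ⟨by omega, h'⟩
        rw [ht, this, Finset.card_insert_of_notMem (by simp [i])]
      have hgi : gapExponent T i = 0 := by rw [gapExponent_apply, if_neg hi]
      rw [hgi, Finsupp.single_zero, add_zero] at hgap
      rw [h1, hgap]
      rw [h2] at hf
      refine ⟨f, ?_, hf1, hmax⟩
      have hq : (p : ℤ) - ((t' + 1 : ℕ) : ℤ) = (p : ℤ) - t' - 1 := by push_cast; ring
      rw [hq] at hf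
      exact minorSpan_sub_one_le _ _ _ hf

theorem partialEsymm_variableSeq_mem_idealJ {k : ℕ} {z : ℕ} (hz : n + 1 ≤ z + k) :
    partialEsymm (variableSeq F n) n z ∈ idealJ F n k := by
  have h : partialEsymm (variableSeq F n) n z = esymm (Fin n) F z := by
    rw [partialEsymm_natCast, esymm_eq_multiset_esymm]
    congr 1
    have hr : Multiset.range n = (Finset.univ : Finset (Fin n)).val.map Fin.val := by
      rw [← Finset.range_val, ← Finset.image_val_of_injOn Fin.val_injective.injOn]
      congr 1
      ext l
      simp only [Finset.mem_range, Finset.mem_image, Finset.mem_univ, true_and]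
      exact ⟨fun h => ⟨⟨l, h⟩, rfl⟩, fun ⟨a, h⟩ => h ▸ a.2⟩
    rw [hr, Multiset.map_map]
    refine Multiset.map_congr rfl fun i _ => ?_
    simp [variableSeq]
  rw [h]
  by_cases hzn : z ≤ n
  · exact Ideal.subset_span (Or.inr ⟨z, ⟨hz, hzn⟩, rfl⟩)
  -- The columns are unbounded, so indices above `n` occur; there the elementary symmetric
  -- polynomial vanishes.
  · rw [esymm, Finset.powersetCard_eq_empty.2 (by simpa using hzn), Finset.sum_empty]
    exact Ideal.zero_mem _

theorem monomial_mem_initialIdeal_of_gapExponent_le {k : ℕ} {T : Finset (Fin n)}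
    (hT : T.card + k = n + 1) {d : Fin n →₀ ℕ} (hd : gapExponent T ≤ d) :
    monomial d (1 : F) ∈ initialIdeal (neglex n) (idealJ F n k) := by
  obtain ⟨f, hf, hf1, hmax⟩ := exists_minorSpan_lead (F := F) T n le_rfl
  have h0 : (Finset.univ.filter fun l : Fin n => n ≤ (l : ℕ) ∧ l ∉ T).card = 0 := by
    rw [Finset.card_eq_zero, Finset.filter_eq_empty_iff]
    intro l _
    have := l.2
    omega
  rw [h0, Finset.filter_true_of_mem (fun i _ => i.2)] at hf
  rw [gapExponentBelow_self] at hf1 hmax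
  refine monomial_mem_initialIdeal ?_ (by rw [hf1]; exact one_ne_zero) hmax hd
  refine (show minorSpan F n n _ 0 ≤ (idealJ F n k).restrictScalars F from
    Submodule.span_le.2 ?_) hf
  rintro _ ⟨a, -, c, rfl⟩
  refine Ideal.mul_mem_left _ _ ?_
  have : hankelMinor (variableSeq F n) n ((T.card : ℤ) - (0 : ℕ)) 0 c =
      partialEsymm (variableSeq F n) n ((T.card + c 0 : ℕ) : ℤ) := by
    simp [hankelMinor]
  rw [this]
  exact partialEsymm_variableSeq_mem_idealJ (by omega)

theorem partialHsymm_eq_sum_monomial (k : ℕ) (i : Fin n) :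
    partialHsymm F k i = ∑ s : Sym {j : Fin n // j ≤ i} k,
      monomial (Multiset.toFinsupp (s.1.map Subtype.val)) (1 : F) := by
  classical
  rw [partialHsymm, hsymm, map_sum]
  refine Finset.sum_congr rfl fun s _ => ?_
  rw [map_multiset_prod, Multiset.map_map]
  induction s.1 using Multiset.induction_on with
  | empty => simp
  | cons a s ih =>
    rw [Multiset.map_cons, Multiset.prod_cons, ih, Function.comp_apply, rename_X, Multiset.map_cons,
      ← Multiset.singleton_add, map_add, Multiset.toFinsupp_singleton, X, monomial_mul, one_mul]

/-- Every monomial of $h_k$ has total degree $k$ and involves no variable beyond the $i$-th, so the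
pure power of the $i$-th is the neglex-largest. -/
theorem monomial_mem_initialIdeal_of_single_le {k : ℕ} {i : Fin n}
    {d : Fin n →₀ ℕ} (hd : Finsupp.single i k ≤ d) :
    monomial d (1 : F) ∈ initialIdeal (neglex n) (idealJ F n k) := by
  classical
  have hval : ∀ (s : Sym {j : Fin n // j ≤ i} k) (l : Fin n),
      (Multiset.toFinsupp (s.1.map Subtype.val) : Fin n →₀ ℕ) l =
        (s.1.map Subtype.val).count l := fun s l => rfl
  refine monomial_mem_initialIdeal (f := partialHsymm F k i)
    (Ideal.subset_span (Or.inl ⟨i, rfl⟩)) (d := Finsupp.single i k) ?_ ?_ hd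
  · rw [partialHsymm_eq_sum_monomial, coeff_sum]
    simp only [coeff_monomial]
    rw [Finset.sum_eq_single (Sym.replicate k (⟨i, le_rfl⟩ : {j : Fin n // j ≤ i}))]
    · rw [if_pos]
      · exact one_ne_zero
      · ext l
        rw [hval]
        simp [Sym.replicate, Multiset.count_replicate, Finsupp.single_apply]
    · intro s _ hs
      rw [if_neg]
      intro h
      apply hs
      have h2 : s.1.map Subtype.val = Multiset.replicate k i := by
        apply Multiset.toFinsupp.injective
        rw [h]
        ext l
        simp [Multiset.count_replicate, Finsupp.single_apply]
      apply Subtype.ext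
      apply Multiset.map_injective Subtype.val_injective
      rw [h2]
      simp [Sym.replicate]
    · simp
  · intro c hc
    rw [partialHsymm_eq_sum_monomial] at hc
    obtain ⟨s, -, hs⟩ := Finset.mem_biUnion.1 (support_sum hc)
    have hc' := Finset.mem_singleton.1 (support_monomial_subset hs)
    have hgt : ∀ l, i < l → c l = 0 := by
      intro l hl
      rw [hc', hval, Multiset.count_eq_zero]
      intro hm
      obtain ⟨a, _, rfl⟩ := Multiset.mem_map.1 hm
      exact absurd a.2 (not_le.2 hl)
    have hcard : (s.1.map Subtype.val).card = k := by rw [Multiset.card_map]; exact s.2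
    have hle : c i ≤ k := by
      rw [hc', hval]
      exact (Multiset.count_le_card _ _).trans hcard.le
    rcases hle.lt_or_eq with h | h
    · refine le_of_lt ((neglex_lt_iff _ _).2 ⟨i, fun l hl => ?_, by simpa using h⟩)
      rw [hgt l hl, Finsupp.single_eq_of_ne hl.ne']
    · refine le_of_eq (congrArg _ ?_)
      rw [hc', hval] at h
      replace h := Multiset.count_eq_card.1 (h.trans hcard.symm)
      have h3 : s.1.map Subtype.val = Multiset.replicate k i :=
        Multiset.eq_replicate.2 ⟨hcard, fun b hb => (h b hb).symm⟩
      rw [hc', h3]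
      ext l
      simp [Multiset.count_replicate, Finsupp.single_apply]

theorem standardMonomials_subset_reverseNonskip (k : ℕ) :
    standardMonomials (neglex n) (idealJ F n k) ⊆ reverseNonskip n k := by
  intro d hd
  refine ⟨fun i hi => hd (monomial_mem_initialIdeal_of_single_le hi), fun S hS hle => hd ?_⟩
  obtain ⟨T, hT, hST⟩ := exists_eq_map_rev S
  rw [hST] at hle
  exact monomial_mem_initialIdeal_of_gapExponent_le (by omega) hle

end LeadingMonomials

/-! ### At most as many reverse nonskip monomials as surjections. -/

section Counting

/-- Read `g` from the last entry to the first with a counter starting at `t`, which is incremented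
at every entry not exceeding its current value: does the counter reach `k`? -/
def CounterReaches (k : ℕ) : (n t : ℕ) → (Fin n → ℕ) → Prop
  | 0, t, _ => k ≤ t
  | n + 1, t, g =>
    if g (Fin.last n) ≤ t then CounterReaches k n (t + 1) fun i => g i.castSucc
    else CounterReaches k n t fun i => g i.castSucc

/-- $T$ collects, from the right, positions where the counter is not incremented. At such a position
$i$ the counter is $t$ plus the number of later positions outside $T$, and $g_i$ exceeds it. If the
counter stays below $k$, there are at least $n+1+t-k$ such positions. -/
theorem exists_finset_of_not_counterReaches {k n t : ℕ} {g : Fin n → ℕ}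
    (hg : ¬ CounterReaches k n t g) (hk : k ≤ n + 1 + t) :
    ∃ T : Finset (Fin n), T.card + k = n + 1 + t ∧
      ∀ i ∈ T, 1 + t + (Finset.univ.filter fun l => i < l ∧ l ∉ T).card ≤ g i := by
  induction n generalizing t with
  | zero =>
    simp only [CounterReaches, not_le] at hg
    exact ⟨∅, by rw [Finset.card_empty]; omega, by simp⟩
  | succ n ih =>
    rw [CounterReaches] at hg
    split_ifs at hg with hlast
    · obtain ⟨T, hT, hTg⟩ := ih hg (by omega)
      refine ⟨T.map Fin.castSuccEmb, by rw [Finset.card_map]; omega, ?_⟩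
      intro i hi
      obtain ⟨i', hi', rfl⟩ := Finset.mem_map.1 hi
      have := hTg i' hi'
      rw [Finset.card_filter] at this
      rw [Finset.card_filter, Fin.sum_univ_castSucc]
      simp only [Fin.coe_castSuccEmb, Fin.castSucc_lt_castSucc_iff, Fin.castSucc_lt_last,
        Finset.mem_map, Fin.castSucc_inj, exists_eq_right, true_and] at this ⊢
      rw [if_pos]
      · omega
      · rintro ⟨a, -, ha⟩
        exact Fin.castSucc_ne_last a ha
    -- In this case no further positions are required, so the collection stops early.
    · by_cases hkt : k = n + 1 + 1 + t
      · exact ⟨∅, by rw [Finset.card_empty]; omega, by simp⟩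
      obtain ⟨T, hT, hTg⟩ := ih hg (by omega)
      have hmem : ∀ l : Fin n, l.castSucc ∈ insert (Fin.last n) (T.map Fin.castSuccEmb) ↔ l ∈ T := by
        intro l
        simp [Fin.castSucc_ne_last]
      refine ⟨insert (Fin.last n) (T.map Fin.castSuccEmb), ?_, ?_⟩
      · rw [Finset.card_insert_of_notMem, Finset.card_map]
        · omega
        · rw [Finset.mem_map]
          rintro ⟨a, -, ha⟩
          exact Fin.castSucc_ne_last a ha
      intro i hi
      rw [Finset.card_filter, Fin.sum_univ_castSucc]
      induction i using Fin.lastCases with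
      | last =>
        rw [if_neg (by simp), Finset.sum_eq_zero]
        · omega
        · intro l _
          rw [if_neg]
          rintro ⟨h, -⟩
          exact absurd (Fin.castSucc_lt_last l) h.not_gt
      | cast i =>
        rw [hmem] at hi
        have := hTg i hi
        rw [Finset.card_filter] at this
        simp only [hmem, Fin.castSucc_lt_castSucc_iff, Finset.mem_insert_self, not_true_eq_false,
          and_false, if_false, add_zero]
        exact this

theorem counterReaches_of_mem_reverseNonskip {n k : ℕ} (hkn : k ≤ n) {d : Fin n →₀ ℕ}
    (hd : d ∈ reverseNonskip n k) : CounterReaches k n 0 d := by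
  by_contra hg
  obtain ⟨T, hT, hTd⟩ := exists_finset_of_not_counterReaches hg (by omega)
  refine hd.2 (T.map Fin.revPerm.toEmbedding) (by rw [Finset.card_map]; omega) ?_
  rw [reverseSkipExponent_map_rev]
  intro i
  rw [gapExponent_apply]
  split_ifs with hi
  · exact hTd i hi
  · exact Nat.zero_le _

theorem sum_snoc {M : Type*} [AddCommMonoid M] (n k : ℕ) (φ : (Fin (n + 1) → Fin k) → M) :
    ∑ g, φ g = ∑ g' : Fin n → Fin k, ∑ a : Fin k, φ (Fin.snoc g' a) := by
  rw [← Fintype.sum_equiv (Fin.snocEquiv fun _ => Fin k)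
    (fun p : Fin k × (Fin n → Fin k) => φ (Fin.snoc p.2 p.1)) φ (fun _ => rfl)]
  exact Fintype.sum_prod_type_right _

-- Both sides satisfy $N(n+1,t)=s\,N(n,t+1)+(k-s)\,N(n,t)$ with $s=\min(t+1,k)$. On the left, $s$ is
-- the number of last entries that increment the counter. On the right, the recurrence holds after
-- summing over the last value of $f$. For $t=0$ the right side counts surjections.
open Classical in
theorem sum_counterReaches_eq (k n t : ℕ) :
    ∑ g : Fin n → Fin k, (if CounterReaches k n t fun i => (g i : ℕ) then 1 else 0) =
      ∑ f : Fin n → Fin k, if k ≤ (Finset.univ.image f).card + t then 1 else 0 := by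
  induction n generalizing t with
  | zero =>
    refine Finset.sum_congr rfl fun f _ => ?_
    have h : (CounterReaches k 0 t fun i => (f i : ℕ)) ↔
        k ≤ (Finset.univ.image f).card + t := by simp [CounterReaches]
    by_cases ht : k ≤ (Finset.univ.image f).card + t
    · rw [if_pos ht, if_pos (h.2 ht)]
    · rw [if_neg ht, if_neg (fun h' => ht (h.1 h'))]
  | succ n ih =>
    set s := (Finset.univ.filter fun a : Fin k => (a : ℕ) ≤ t).card with hs
    have hsk : s = min (t + 1) k := by
      rw [hs]
      simpa [Nat.lt_succ_iff, min_comm] using Fin.card_filter_val_lt (n := k) (m := t + 1)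
    have hcount : ∀ (P : Fin k → Prop) [DecidablePred P] (u v : ℕ),
        ∑ a : Fin k, (if P a then u else v) = (Finset.univ.filter P).card * u +
          (k - (Finset.univ.filter P).card) * v := by
      intro P _ u v
      rw [Finset.sum_ite, Finset.sum_const, Finset.sum_const, smul_eq_mul, smul_eq_mul]
      congr 2
      have := Finset.card_filter_add_card_filter_not (s := (Finset.univ : Finset (Fin k))) P
      rw [Finset.card_univ, Fintype.card_fin] at this
      omega
    have hL : ∀ g' : Fin n → Fin k, ∑ a : Fin k,
        (if CounterReaches k (n + 1) t fun i => ((Fin.snoc g' a : Fin (n + 1) → Fin k) i : ℕ)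
          then 1 else 0) =
        s * (if CounterReaches k n (t + 1) fun i => (g' i : ℕ) then 1 else 0) +
        (k - s) * (if CounterReaches k n t fun i => (g' i : ℕ) then 1 else 0) := by
      intro g'
      rw [hs, ← hcount]
      refine Finset.sum_congr rfl fun a _ => ?_
      simp only [CounterReaches, Fin.snoc_last, Fin.snoc_castSucc]
      split_ifs <;> rfl
    have hR : ∀ f' : Fin n → Fin k, ∑ a : Fin k,
        (if k ≤ (Finset.univ.image (Fin.snoc f' a : Fin (n + 1) → Fin k)).card + t
          then 1 else 0) =
        s * (if k ≤ (Finset.univ.image f').card + (t + 1) then 1 else 0) +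
        (k - s) * (if k ≤ (Finset.univ.image f').card + t then 1 else 0) := by
      intro f'
      set m := (Finset.univ.image f').card with hm
      have hmk : m ≤ k := by simpa using Finset.card_le_univ (Finset.univ.image f')
      have him : ∀ a, Finset.univ.image (Fin.snoc f' a : Fin (n + 1) → Fin k) =
          insert a (Finset.univ.image f') := by
        intro a
        ext b
        simp only [Finset.mem_image, Finset.mem_univ, true_and, Finset.mem_insert]
        rw [Fin.exists_fin_succ']
        simp only [Fin.snoc_castSucc, Fin.snoc_last]
        rw [or_comm, eq_comm]
      have hsum : ∀ a : Fin k,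
          (if k ≤ (Finset.univ.image (Fin.snoc f' a : Fin (n + 1) → Fin k)).card + t
            then 1 else 0) =
          if a ∈ Finset.univ.image f' then (if k ≤ m + t then 1 else 0)
            else (if k ≤ m + 1 + t then 1 else 0) := by
        intro a
        rw [him, Finset.card_insert_eq_ite]
        by_cases ha : a ∈ Finset.univ.image f' <;> simp only [ha, if_true, if_false, ← hm]
      rw [Finset.sum_congr rfl fun a _ => hsum a, hcount, Finset.filter_mem_eq_inter,
        Finset.univ_inter, ← hm]
      -- Both sides are $k$ if $k\le m+t$, are $t+1$ if $k=m+t+1$, and vanish otherwise.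
      rw [hsk]
      split_ifs <;> simp <;> omega
    rw [sum_snoc, sum_snoc]
    simp only [hL, hR, Finset.sum_add_distrib, ← Finset.mul_sum, ih]

theorem finite_reverseNonskip (n k : ℕ) : (reverseNonskip n k).Finite := by
  refine (Set.finite_Iic (Finsupp.equivFunOnFinite.symm fun _ : Fin n => k)).subset ?_
  intro d hd i
  by_contra h
  exact hd.1 i (Finsupp.single_le_iff.2 (not_le.1 h).le)

theorem card_reverseNonskip_le {n k : ℕ} (hkn : k ≤ n) :
    Nat.card (reverseNonskip n k) ≤
      Nat.card {f : Fin n → Fin k // Function.Surjective f} := by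
  classical
  have hcard : Nat.card {f : Fin n → Fin k // Function.Surjective f} =
      Nat.card {g : Fin n → Fin k // CounterReaches k n 0 fun i => (g i : ℕ)} := by
    rw [Nat.card_eq_fintype_card, Nat.card_eq_fintype_card, Fintype.card_subtype,
      Fintype.card_subtype, Finset.card_filter, Finset.card_filter, sum_counterReaches_eq]
    refine Finset.sum_congr rfl fun f _ => ?_
    congr 1
    rw [eq_iff_iff, add_zero]
    constructor
    · intro h
      rw [Finset.image_univ_of_surjective h, Finset.card_univ, Fintype.card_fin]
    · intro h i
      have : Finset.univ.image f = Finset.univ := by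
        rw [← Finset.card_eq_iff_eq_univ, Fintype.card_fin]
        exact le_antisymm (by simpa using Finset.card_le_univ (Finset.univ.image f)) h
      simpa using this.ge (Finset.mem_univ i)
  rw [hcard]
  have hlt : ∀ d : reverseNonskip n k, ∀ i, (d : Fin n →₀ ℕ) i < k := by
    intro d i
    by_contra h
    exact d.2.1 i (Finsupp.single_le_iff.2 (not_lt.1 h))
  refine Nat.card_le_card_of_injective
    (fun d => ⟨fun i => ⟨(d : Fin n →₀ ℕ) i, hlt d i⟩,
      counterReaches_of_mem_reverseNonskip hkn d.2⟩) ?_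
  intro d e h
  apply Subtype.ext
  ext i
  have := congrFun (congrArg Subtype.val h) i
  exact congrArg Fin.val this

/-- Ordered set partitions are the families of fibres of surjections. -/
theorem card_orderedSetPartition (n k : ℕ) :
    Nat.card (OrderedSetPartition n k) =
      Nat.card {f : Fin n → Fin k // Function.Surjective f} := by
  symm
  refine Nat.card_eq_of_bijective (fun f => ⟨fun i => Finset.univ.filter fun x => f.1 x = i,
    fun i => ?_, fun i j hij => ?_, fun x => ⟨f.1 x, by simp⟩⟩) ⟨?_, ?_⟩
  · obtain ⟨x, hx⟩ := f.2 i
    exact ⟨x, by simpa using hx⟩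
  · rw [Finset.disjoint_left]
    intro x hx hx'
    simp only [Finset.mem_filter, Finset.mem_univ, true_and] at hx hx'
    exact hij (hx.symm.trans hx')
  · intro f g h
    apply Subtype.ext
    funext x
    have h1 := congrFun (congrArg Subtype.val h) (g.1 x)
    have h2 : x ∈ Finset.univ.filter fun y => g.1 y = g.1 x := by simp
    have h3 : x ∈ Finset.univ.filter fun y => f.1 y = g.1 x := by
      rw [show (Finset.univ.filter fun y => f.1 y = g.1 x) = _ from h1]
      exact h2
    simpa using h3
  · rintro ⟨B, hne, hdisj, hcov⟩
    choose f hf using id hcov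
    have huniq : ∀ x i, x ∈ B i → f x = i := by
      intro x i hx
      by_contra h
      exact Finset.disjoint_left.1 (hdisj _ _ h) (hf x) hx
    refine ⟨⟨f, fun i => ?_⟩, ?_⟩
    · obtain ⟨x, hx⟩ := hne i
      exact ⟨x, huniq x i hx⟩
    · apply Subtype.ext
      funext i
      ext x
      simp only [Finset.mem_filter, Finset.mem_univ, true_and]
      exact ⟨fun h => h ▸ hf x, huniq x i⟩

end Counting

/-! ### Spanning sets survive deformation of a homogeneous ideal. -/

section Deformation

variable {σ F K : Type*} [Field F] [Field K] [Algebra F K]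

theorem degree_eq_of_isHomogeneous {d : ℕ} {p : MvPolynomial σ K} (hp : p.IsHomogeneous d)
    {c : σ →₀ ℕ} (hc : c ∈ p.support) : c.degree = d := by
  rw [Finsupp.degree_eq_weight_one]
  exact hp (mem_support_iff.1 hc)

theorem mul_mem_restrictSupport_degree_lt {d e : ℕ} {p q : MvPolynomial σ K}
    (hp : p.IsHomogeneous d) (hq : q ∈ restrictSupport K {c : σ →₀ ℕ | c.degree < e}) :
    p * q ∈ restrictSupport K {c : σ →₀ ℕ | c.degree < d + e} := by
  refine mul_mem_restrictSupport (s := {c | c.degree = d}) ?_ hq fun a ha b hb => ?_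
  · rw [mem_restrictSupport_iff]
    intro c hc
    exact degree_eq_of_isHomogeneous hp hc
  · have ha' : a.degree = d := ha
    have hb' : b.degree < e := hb
    change (a + b).degree < d + e
    rw [map_add]
    omega

theorem homogeneousComponent_mul_of_isHomogeneous {e : ℕ} (g : MvPolynomial σ F)
    {f : MvPolynomial σ F} (hf : f.IsHomogeneous e) (d : ℕ) :
    homogeneousComponent d (g * f) = if e ≤ d then homogeneousComponent (d - e) g * f else 0 := by
  let _ : GradedAlgebra (homogeneousSubmodule σ F) := gradedAlgebra
  rw [← decomposition.decompose'_apply, ← decomposition.decompose'_apply]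
  exact DirectSum.coe_decompose_mul_of_right_mem (homogeneousSubmodule σ F) d hf

/-- If the homogeneous generators of an ideal are top forms of elements of `N`, then every
homogeneous component of an element of that ideal is a top form of an element of `N`. -/
theorem exists_mem_sub_homogeneousComponent {G : Set (MvPolynomial σ F)}
    {N : Ideal (MvPolynomial σ K)}
    (hG : ∀ f ∈ G, ∃ e, f.IsHomogeneous e ∧ ∃ P ∈ N,
      P - map (algebraMap F K) f ∈ restrictSupport K {c : σ →₀ ℕ | c.degree < e})
    {f : MvPolynomial σ F} (hf : f ∈ Ideal.span G) (d : ℕ) :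
    ∃ P ∈ N, P - map (algebraMap F K) (homogeneousComponent d f) ∈
      restrictSupport K {c : σ →₀ ℕ | c.degree < d} := by
  -- The arbitrary multiplier `g` lets the induction over the span absorb polynomial coefficients.
  suffices ∀ g : MvPolynomial σ F, ∃ P ∈ N,
      P - map (algebraMap F K) (homogeneousComponent d (g * f)) ∈
        restrictSupport K {c : σ →₀ ℕ | c.degree < d} by
    simpa using this 1
  induction hf using Submodule.span_induction with
  | mem f hf =>
    intro g
    obtain ⟨e, he, P, hP, hPf⟩ := hG f hf
    rw [homogeneousComponent_mul_of_isHomogeneous g he]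
    split_ifs with hed
    · set g' := homogeneousComponent (d - e) g
      have hg' : (map (algebraMap F K) g').IsHomogeneous (d - e) :=
        (homogeneousComponent_isHomogeneous _ _).map _
      refine ⟨map (algebraMap F K) g' * P, N.mul_mem_left _ hP, ?_⟩
      rw [map_mul, ← mul_sub]
      have := mul_mem_restrictSupport_degree_lt hg' hPf
      rwa [Nat.sub_add_cancel hed] at this
    · exact ⟨0, N.zero_mem, by simp⟩
  | zero => exact fun g => ⟨0, N.zero_mem, by simp⟩
  | add f₁ f₂ _ _ h₁ h₂ =>
    intro g
    obtain ⟨P₁, hP₁, h₁⟩ := h₁ g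
    obtain ⟨P₂, hP₂, h₂⟩ := h₂ g
    refine ⟨P₁ + P₂, N.add_mem hP₁ hP₂, ?_⟩
    rw [mul_add, map_add, map_add, add_sub_add_comm]
    exact Submodule.add_mem _ h₁ h₂
  | smul r f _ h =>
    intro g
    obtain ⟨P, hP, h⟩ := h (g * r)
    refine ⟨P, hP, ?_⟩
    rwa [smul_eq_mul, ← mul_assoc]

/-- Monomials spanning modulo an ideal also span modulo every deformation of that ideal. -/
theorem span_monomials_sup_eq_top_of_deformation {G : Set (MvPolynomial σ F)}
    {N : Ideal (MvPolynomial σ K)}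
    (hG : ∀ f ∈ G, ∃ e, f.IsHomogeneous e ∧ ∃ P ∈ N,
      P - map (algebraMap F K) f ∈ restrictSupport K {c : σ →₀ ℕ | c.degree < e})
    {B : Set (σ →₀ ℕ)}
    (hB : Submodule.span F ((fun b => monomial b (1 : F)) '' B) ⊔
      (Ideal.span G).restrictScalars F = ⊤) :
    Submodule.span K ((fun b => monomial b (1 : K)) '' B) ⊔ N.restrictScalars K = ⊤ := by
  classical
  set M := Submodule.span K ((fun b => monomial b (1 : K)) '' B) ⊔ N.restrictScalars K
  have hBM : ∀ d, ∀ a ∈ Submodule.span F ((fun b => monomial b (1 : F)) '' B),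
      map (algebraMap F K) (homogeneousComponent d a) ∈ M := by
    intro d a ha
    induction ha using Submodule.span_induction with
    | mem a ha =>
      obtain ⟨b, hb, rfl⟩ := ha
      rw [homogeneousComponent_of_mem (isHomogeneous_monomial _ rfl)]
      split_ifs
      · rw [map_monomial, map_one]
        exact Submodule.mem_sup_left (Submodule.subset_span ⟨b, hb, rfl⟩)
      · rw [map_zero]
        exact Submodule.zero_mem _
    | zero =>
      rw [map_zero, map_zero]
      exact Submodule.zero_mem _
    | add x y _ _ hx hy =>
      rw [map_add, map_add]
      exact Submodule.add_mem _ hx hy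
    | smul r x _ hx =>
      rw [map_smul, smul_eq_C_mul, map_mul, map_C, ← smul_eq_C_mul]
      exact Submodule.smul_mem _ _ hx
  -- Induction on degree: in degree `d` the monomial is a combination of `B` plus the component of
  -- an ideal element, and the latter agrees with an element of `N` up to lower degree.
  have key : ∀ d, ∀ c : σ →₀ ℕ, c.degree = d → monomial c (1 : K) ∈ M := by
    intro d
    induction d using Nat.strong_induction_on with
    | _ d ih =>
      intro c hc
      have hlow : restrictSupport K {c : σ →₀ ℕ | c.degree < d} ≤ M := by
        rw [restrictSupport_eq_span, Submodule.span_le]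
        rintro _ ⟨c', hc', rfl⟩
        exact ih _ hc' c' rfl
      have hmem : monomial c (1 : F) ∈ Submodule.span F ((fun b => monomial b (1 : F)) '' B) ⊔
          (Ideal.span G).restrictScalars F := by
        rw [hB]
        trivial
      obtain ⟨a, ha, f, hf, haf⟩ := Submodule.mem_sup.1 hmem
      obtain ⟨P, hP, hPf⟩ := exists_mem_sub_homogeneousComponent hG hf d
      have h1 : monomial c (1 : K) = map (algebraMap F K) (homogeneousComponent d a) +
          map (algebraMap F K) (homogeneousComponent d f) := by
        rw [← map_add, ← map_add, haf,
          homogeneousComponent_eq_self (isHomogeneous_monomial _ hc), map_monomial,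
          map_one (algebraMap F K)]
      have h2 : map (algebraMap F K) (homogeneousComponent d f) ∈ M := by
        have hPM : P ∈ M := Submodule.mem_sup_right (show P ∈ N.restrictScalars K from hP)
        have := M.sub_mem hPM (hlow hPf)
        rwa [sub_sub_cancel] at this
      rw [h1]
      exact M.add_mem (hBM d a ha) h2
  rw [eq_top_iff]
  rintro p -
  rw [p.as_sum]
  refine Submodule.sum_mem _ fun c _ => ?_
  have := M.smul_mem (p.coeff c) (key _ c rfl)
  rwa [smul_monomial, smul_eq_mul, mul_one] at this

end Deformation

/-! ### Functions on a finite set of points. -/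

section Interpolation

variable {σ K ι : Type*} [Field K]

/-- The polynomials vanishing at a family of points. -/
def vanishingIdealOfPoints (pt : ι → σ → K) : Ideal (MvPolynomial σ K) where
  carrier := {p | ∀ s, eval (pt s) p = 0}
  add_mem' {p q} hp hq s := by rw [map_add, hp s, hq s, add_zero]
  zero_mem' s := map_zero _
  smul_mem' r p hp s := by rw [smul_eq_mul, map_mul, hp s, mul_zero]

/-- Lagrange interpolation: for every other point, a coordinate where it differs from `s` gives an
affine factor equal to 1 at `s` and 0 there; the product of these factors works. -/
theorem exists_eval_eq_single [Finite ι] [DecidableEq ι] {pt : ι → σ → K}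
    (hpt : Function.Injective pt) (s : ι) :
    ∃ p : MvPolynomial σ K, ∀ s', eval (pt s') p = if s' = s then 1 else 0 := by
  have := Fintype.ofFinite ι
  have hsep : ∀ s', ∃ q : MvPolynomial σ K, eval (pt s) q = 1 ∧ (s' ≠ s → eval (pt s') q = 0) := by
    intro s'
    by_cases h : s' = s
    · exact ⟨1, by simp, fun h' => absurd h h'⟩
    · obtain ⟨i, hi⟩ := Function.ne_iff.1 (hpt.ne h)
      refine ⟨C (pt s i - pt s' i)⁻¹ * (X i - C (pt s' i)), ?_, fun _ => by simp⟩
      have : pt s i - pt s' i ≠ 0 := sub_ne_zero.2 (Ne.symm hi)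
      simp [this]
  choose q hq hq' using hsep
  refine ⟨∏ s', q s', fun s' => ?_⟩
  rw [map_prod]
  split_ifs with h
  · rw [h]
    exact Finset.prod_eq_one fun i _ => hq i
  · exact Finset.prod_eq_zero (Finset.mem_univ s') (hq' s' h)

/-- Monomials spanning the functions on a finite set of points are at least as many as the
points. -/
theorem card_points_le_of_span_sup [Finite ι] {pt : ι → σ → K} (hpt : Function.Injective pt)
    {B : Set (σ →₀ ℕ)} (hBfin : B.Finite)
    (hB : Submodule.span K ((fun b => monomial b (1 : K)) '' B) ⊔
      (vanishingIdealOfPoints pt).restrictScalars K = ⊤) :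
    Nat.card ι ≤ Nat.card B := by
  classical
  have := Fintype.ofFinite ι
  have := hBfin.fintype
  let ev : MvPolynomial σ K →ₗ[K] (ι → K) := LinearMap.pi fun s => (aeval (pt s)).toLinearMap
  have hev : ∀ p s, ev p s = eval (pt s) p := fun p s => by
    simp [ev, aeval_eq_eval]
  have hsurj : LinearMap.range ev = ⊤ := by
    rw [LinearMap.range_eq_top]
    intro v
    choose p hp using fun s => exists_eval_eq_single hpt s
    refine ⟨∑ s, C (v s) * p s, ?_⟩
    funext s
    rw [hev, map_sum]
    simp [hp]
  have hker : ((vanishingIdealOfPoints pt).restrictScalars K).map ev = ⊥ := by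
    rw [eq_bot_iff]
    rintro _ ⟨p, hp, rfl⟩
    rw [Submodule.mem_bot]
    funext s
    rw [hev]
    exact hp s
  have htop : Submodule.span K (Set.range fun b : B => ev (monomial (b : σ →₀ ℕ) 1)) = ⊤ := by
    rw [← hsurj, LinearMap.range_eq_map, ← hB, Submodule.map_sup, hker, sup_bot_eq,
      Submodule.map_span, ← Set.image_comp, Set.image_eq_range]
    rfl
  have h := finrank_range_le_card (R := K) fun b : B => ev (monomial (b : σ →₀ ℕ) 1)
  rw [Set.finrank, htop, finrank_top, Module.finrank_fintype_fun_eq_card] at h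
  rwa [Nat.card_eq_fintype_card, Nat.card_eq_fintype_card]

end Interpolation

/-! ### Generating functions of $h_r$ and $e_r$. -/

section GeneratingFunctions

variable {R ι : Type*} [CommRing R]

/-- The generating function `∏ 1 / (1 - x_i u)` of the complete homogeneous symmetric functions. -/
noncomputable def hSeries (x : ι → R) (s : Finset ι) : PowerSeries R :=
  ∏ i ∈ s, PowerSeries.mk fun a => x i ^ a

/-- The generating function `∏ (1 + x_i u)` of the elementary symmetric functions. -/
noncomputable def eSeries (x : ι → R) (s : Finset ι) : PowerSeries R :=
  ∏ i ∈ s, (1 + PowerSeries.C (x i) * PowerSeries.X)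

theorem coeff_eSeries (x : ι → R) (s : Finset ι) (r : ℕ) :
    PowerSeries.coeff r (eSeries x s) = ∑ t ∈ s.powersetCard r, ∏ i ∈ t, x i := by
  classical
  rw [eSeries, Finset.prod_one_add, map_sum, Finset.powersetCard_eq_filter, Finset.sum_filter]
  refine Finset.sum_congr rfl fun t _ => ?_
  rw [Finset.prod_mul_distrib, Finset.prod_const, ← map_prod, PowerSeries.coeff_C_mul,
    PowerSeries.coeff_X_pow]
  by_cases h : t.card = r
  · rw [if_pos h.symm, if_pos h, mul_one]
  · rw [if_neg (Ne.symm h), if_neg h, mul_zero]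

theorem coeff_eSeries_of_card_lt (x : ι → R) (s : Finset ι) {r : ℕ} (hr : s.card < r) :
    PowerSeries.coeff r (eSeries x s) = 0 := by
  rw [coeff_eSeries, Finset.powersetCard_eq_empty.2 hr, Finset.sum_empty]

theorem coeff_hSeries_univ [Fintype ι] [DecidableEq ι] (x : ι → R) (r : ℕ) :
    PowerSeries.coeff r (hSeries x Finset.univ) = ∑ s : Sym ι r, (s.1.map x).prod := by
  rw [hSeries, PowerSeries.coeff_prod]
  simp only [PowerSeries.coeff_mk]
  symm
  refine Finset.sum_bij (fun s _ => Multiset.toFinsupp s.1) ?_ ?_ ?_ ?_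
  · intro s _
    rw [Finset.mem_finsuppAntidiag]
    refine ⟨?_, Finset.subset_univ _⟩
    have h := Multiset.toFinsupp_sum_eq s.1
    rw [Finsupp.sum_fintype _ _ (fun _ => rfl)] at h
    exact h.trans s.2
  · intro s _ s' _ h
    exact Subtype.ext (Multiset.toFinsupp.injective h)
  · intro l hl
    rw [Finset.mem_finsuppAntidiag] at hl
    refine ⟨⟨Finsupp.toMultiset l, ?_⟩, Finset.mem_univ _, Finsupp.toMultiset_toFinsupp l⟩
    rw [Finsupp.card_toMultiset, Finsupp.sum_fintype _ _ (fun _ => rfl)]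
    exact hl.1
  · intro s _
    rw [Finset.prod_multiset_map_count]
    refine Finset.prod_subset (Finset.subset_univ _) fun i _ hi => ?_
    rw [Multiset.count_eq_zero.2 (fun h => hi (Multiset.mem_toFinset.2 h)), pow_zero]

theorem mk_neg_pow_mul (a : R) :
    (PowerSeries.mk fun m => (-a) ^ m) * (1 + PowerSeries.C a * PowerSeries.X) = 1 := by
  ext m
  rw [mul_add, mul_one, mul_comm (PowerSeries.C a), ← mul_assoc, map_add]
  cases m with
  | zero => simp
  | succ m =>
    rw [PowerSeries.coeff_mul_C, PowerSeries.coeff_succ_mul_X, PowerSeries.coeff_mk,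
      PowerSeries.coeff_mk, PowerSeries.coeff_one, if_neg (Nat.succ_ne_zero m)]
    ring

theorem hSeries_neg_mul_eSeries [DecidableEq ι] (x : ι → R) {s t : Finset ι} (h : s ⊆ t) :
    hSeries (fun i => -x i) s * eSeries x t = eSeries x (t \ s) := by
  have h1 : hSeries (fun i => -x i) s * eSeries x s = 1 := by
    rw [hSeries, eSeries, ← Finset.prod_mul_distrib]
    exact Finset.prod_eq_one fun i _ => mk_neg_pow_mul _
  rw [eSeries, ← Finset.prod_sdiff h, mul_comm (∏ i ∈ t \ s, _), ← mul_assoc]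
  exact (congrArg (· * _) h1).trans (one_mul _)

/-- The coefficients of `∏_{i ∈ t} (1 + x_i u) / ∏_{i ∈ s} (1 + x_i u)` above degree `#t - #s`
vanish. -/
theorem sum_antidiagonal_hSeries_eSeries [DecidableEq ι] (x : ι → R) {s t : Finset ι} (h : s ⊆ t)
    {r : ℕ} (hr : t.card < r + s.card) :
    ∑ p ∈ Finset.HasAntidiagonal.antidiagonal r, PowerSeries.coeff p.1 (hSeries (fun i => -x i) s) *
      PowerSeries.coeff p.2 (eSeries x t) = 0 := by
  rw [← PowerSeries.coeff_mul, hSeries_neg_mul_eSeries x h]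
  refine coeff_eSeries_of_card_lt _ _ ?_
  have := Finset.card_le_card h
  rw [Finset.card_sdiff_of_subset h]
  omega

theorem coeff_zero_hSeries (x : ι → R) (s : Finset ι) :
    PowerSeries.coeff 0 (hSeries x s) = 1 := by
  rw [PowerSeries.coeff_zero_eq_constantCoeff_apply, hSeries, map_prod]
  refine Finset.prod_eq_one fun i _ => ?_
  simp [← PowerSeries.coeff_zero_eq_constantCoeff_apply]

theorem coeff_zero_eSeries (x : ι → R) (s : Finset ι) :
    PowerSeries.coeff 0 (eSeries x s) = 1 := by
  rw [coeff_eSeries]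
  simp

end GeneratingFunctions

/-! ### Homogeneity and evaluation of the generators. -/

section SymmetricPolynomials

variable {F K : Type*} [Field F] [Field K] [Algebra F K] {n : ℕ}

theorem isHomogeneous_partialHsymm (k : ℕ) (i : Fin n) : (partialHsymm F k i).IsHomogeneous k := by
  rw [partialHsymm]
  refine IsHomogeneous.rename_isHomogeneous ?_
  rw [hsymm]
  refine IsHomogeneous.sum _ _ _ fun s _ => ?_
  have h : ∀ m : Multiset {j : Fin n // j ≤ i},
      ((m.map X).prod : MvPolynomial {j : Fin n // j ≤ i} F).IsHomogeneous m.card := by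
    intro m
    induction m using Multiset.induction_on with
    | empty => simpa using isHomogeneous_one _ F
    | cons a m ih =>
      rw [Multiset.map_cons, Multiset.prod_cons, Multiset.card_cons, add_comm]
      exact (isHomogeneous_X F a).mul ih
  have := h s.1
  rwa [s.2] at this

theorem isHomogeneous_esymm (r : ℕ) : (esymm (Fin n) F r).IsHomogeneous r := by
  rw [esymm]
  refine IsHomogeneous.sum _ _ _ fun t ht => ?_
  have := IsHomogeneous.prod t (fun i => (X i : MvPolynomial (Fin n) F)) (fun _ => 1)
    fun i _ => isHomogeneous_X F i
  rwa [Finset.sum_const, smul_eq_mul, mul_one, (Finset.mem_powersetCard.1 ht).2] at this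

theorem map_partialHsymm (k : ℕ) (i : Fin n) :
    map (algebraMap F K) (partialHsymm F k i) = partialHsymm K k i := by
  rw [partialHsymm, map_rename, map_hsymm, partialHsymm]

theorem eval_partialHsymm (k : ℕ) (i : Fin n) (y : Fin n → K) :
    eval y (partialHsymm K k i) =
      PowerSeries.coeff k (hSeries (fun j : {j : Fin n // j ≤ i} => y j) Finset.univ) := by
  rw [partialHsymm, eval_rename, coeff_hSeries_univ, hsymm, map_sum]
  refine Finset.sum_congr rfl fun s _ => ?_
  rw [map_multiset_prod, Multiset.map_map]
  simp [Function.comp_def]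

theorem eval_esymm (r : ℕ) (y : Fin n → K) :
    eval y (esymm (Fin n) K r) = PowerSeries.coeff r (eSeries y Finset.univ) := by
  rw [coeff_eSeries, esymm, map_sum]
  refine Finset.sum_congr rfl fun s _ => ?_
  simp

theorem mem_restrictSupport_of_isHomogeneous {σ : Type*} {p : MvPolynomial σ K} {d e : ℕ}
    (hp : p.IsHomogeneous d) (hde : d < e) :
    p ∈ restrictSupport K {c : σ →₀ ℕ | c.degree < e} := by
  rw [mem_restrictSupport_iff]
  intro c hc
  exact (degree_eq_of_isHomogeneous hp hc).trans_lt hde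

/-- A combination `∑ f a * v b` over `a + b = r` with `v 0 = 1` has top form `f r`. -/
theorem sum_antidiagonal_sub_mem {σ : Type*} {f : ℕ → MvPolynomial σ K}
    (hf : ∀ a, (f a).IsHomogeneous a) {v : ℕ → K} (hv : v 0 = 1) (r : ℕ) :
    ∑ p ∈ Finset.HasAntidiagonal.antidiagonal r, v p.2 • f p.1 - f r ∈
      restrictSupport K {c : σ →₀ ℕ | c.degree < r} := by
  have hmem : (r, 0) ∈ Finset.HasAntidiagonal.antidiagonal r := by simp
  rw [← Finset.add_sum_erase _ _ hmem, hv, one_smul, add_sub_cancel_left]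
  refine Submodule.sum_mem _ fun p hp => Submodule.smul_mem _ _ ?_
  rw [Finset.mem_erase, Finset.HasAntidiagonal.mem_antidiagonal] at hp
  refine mem_restrictSupport_of_isHomogeneous (hf _) ?_
  have : p.2 ≠ 0 := fun h => hp.1 (Prod.ext (by simp; omega) h)
  omega

end SymmetricPolynomials

/-! ### Points encoding surjections, and the lower bound. -/

section Points

variable {n k : ℕ}

/-- A surjection `c` encoded by distinct labels: the first index with a given value `v` gets the
label `v`, and any other index `i` gets `k + l`, where `l` is the preceding index with the same
value. -/
def label (c : Fin n → Fin k) (i : Fin n) : ℕ :=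
  if h : (Finset.univ.filter fun l => l < i ∧ c l = c i).Nonempty then
    k + (Finset.univ.filter fun l => l < i ∧ c l = c i).max' h
  else c i

theorem label_spec (c : Fin n → Fin k) (i : Fin n) :
    (label c i = c i ∧ ∀ l < i, c l ≠ c i) ∨
      ∃ l < i, c l = c i ∧ label c i = k + l ∧ ∀ l' < i, c l' = c i → l' ≤ l := by
  unfold label
  split_ifs with h
  · right
    have hm := Finset.max'_mem _ h
    simp only [Finset.mem_filter, Finset.mem_univ, true_and] at hm
    refine ⟨_, hm.1, hm.2, rfl, fun l' hl' hc => Finset.le_max' _ _ ?_⟩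
    simp [hl', hc]
  · left
    refine ⟨rfl, fun l hl hc => h ⟨l, ?_⟩⟩
    simp [hl, hc]

theorem label_lt (c : Fin n → Fin k) (i : Fin n) : label c i < k + i := by
  rcases label_spec c i with ⟨h, -⟩ | ⟨l, hl, -, h, -⟩
  · rw [h]
    have := (c i).2
    omega
  · rw [h]
    have : (l : ℕ) < i := hl
    omega

/-- Labels below `k` mark first occurrences of distinct values; a label `k + l` determines its index
as the next occurrence after `l` of the value at `l`. -/
theorem label_injective (c : Fin n → Fin k) : Function.Injective (label c) := by
  have key : ∀ i j, i < j → label c i ≠ label c j := by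
    intro i j hij h
    rcases label_spec c i with ⟨hi, -⟩ | ⟨l, hl, hlc, hi, -⟩ <;>
      rcases label_spec c j with ⟨hj, hj'⟩ | ⟨l', hl', hlc', hj, hmax⟩
    · exact hj' i hij (Fin.ext (by omega))
    · have := (c i).2
      omega
    · have := (c j).2
      omega
    · have hll : l = l' := Fin.ext (by omega)
      subst hll
      exact absurd (hmax i hij (hlc.symm.trans hlc')) (not_le.2 hl)
  intro i j h
  rcases lt_trichotomy i j with hij | hij | hij
  · exact absurd h (key i j hij)
  · exact hij
  · exact absurd h.symm (key j i hij)

/-- The values are recovered from left to right: a label either is the value or names an earlier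
index with the same value. -/
theorem label_inj : Function.Injective (label : (Fin n → Fin k) → Fin n → ℕ) := by
  intro c c' h
  funext i
  induction i using WellFoundedLT.induction with
  | ind i ih =>
    have hi := congrFun h i
    rcases label_spec c i with ⟨h1, -⟩ | ⟨l, hl, hlc, h1, -⟩ <;>
      rcases label_spec c' i with ⟨h2, -⟩ | ⟨l', hl', hlc', h2, -⟩
    · exact Fin.ext (by omega)
    · have := (c i).2
      omega
    · have := (c' i).2
      omega
    · have hll : l = l' := Fin.ext (by omega)
      subst hll
      rw [← hlc, ← hlc', ih l hl]

theorem exists_label_eq {c : Fin n → Fin k} (hc : Function.Surjective c) (v : Fin k) :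
    ∃ i, label c i = v := by
  obtain ⟨i, hi, hmin⟩ := WellFounded.has_min (wellFounded_lt (α := Fin n)) {i | c i = v} (hc v)
  refine ⟨i, ?_⟩
  rcases label_spec c i with ⟨h, -⟩ | ⟨l, hl, hlc, -, -⟩
  · rw [h, show c i = v from hi]
  · exact absurd hl (hmin l (hlc.trans hi))

/-- The point of `K ^ n` encoding a surjection, for a sequence `α` of scalars. -/
def surjectionPoint {K : Type*} (α : ℕ → K) (c : {c : Fin n → Fin k // Function.Surjective c}) : Fin n → K :=
  fun i => α (label c.1 i)

theorem surjectionPoint_injective {K : Type*} {α : ℕ → K} (hα : Function.Injective α) :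
    Function.Injective (surjectionPoint α : {c : Fin n → Fin k // Function.Surjective c} → _) := by
  intro c c' h
  refine Subtype.ext (label_inj (funext fun i => hα (congrFun h i)))

variable {F K : Type*} [Field F] [Field K] [Algebra F K]

/-- With 0-based $i$, the coordinates $y_0,\dots,y_i$ are distinct members of
$\alpha_0,\dots,\alpha_{k+i-1}$. So $\prod_{l<k+i}(1-\alpha_l u)/\prod_{j\le i}(1-y_j u)$ is a
polynomial of degree at most $k-1$. Its coefficient of $u^k$ is the vanishing polynomial, with top
form $h_k$. -/
theorem exists_deformation_partialHsymm (α : ℕ → K) (i : Fin n) :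
    ∃ P ∈ vanishingIdealOfPoints
        (surjectionPoint α : {c : Fin n → Fin k // Function.Surjective c} → _),
      P - map (algebraMap F K) (partialHsymm F k i) ∈
        restrictSupport K {c : Fin n →₀ ℕ | c.degree < k} := by
  rw [map_partialHsymm]
  refine ⟨_, ?_, sum_antidiagonal_sub_mem (fun a => isHomogeneous_partialHsymm a i)
    (v := fun b => PowerSeries.coeff b (eSeries (fun l => -α l) (Finset.range (k + i))))
    (coeff_zero_eSeries (fun l => -α l) (Finset.range (k + i))) k⟩
  intro c
  have hinj : Function.Injective fun j : {j : Fin n // j ≤ i} => label c.1 j :=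
    (label_injective c.1).comp Subtype.val_injective
  set s := Finset.univ.image fun j : {j : Fin n // j ≤ i} => label c.1 j with hs
  have hser : hSeries (fun j : {j : Fin n // j ≤ i} => surjectionPoint α c j) Finset.univ =
      hSeries (fun l => -(-α l)) s := by
    rw [hSeries, hSeries, hs, Finset.prod_image hinj.injOn]
    simp only [neg_neg]
    rfl
  have hst : s ⊆ Finset.range (k + i) := by
    intro l hl
    obtain ⟨j, -, rfl⟩ := Finset.mem_image.1 hl
    have h1 := label_lt c.1 j
    have h2 : ((j : Fin n) : ℕ) ≤ i := j.2
    rw [Finset.mem_range]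
    omega
  have hcard : s.card = i + 1 := by
    rw [hs, Finset.card_image_of_injective _ hinj, Finset.card_univ, Fintype.card_subtype]
    rw [← Fin.card_Iic]
    congr 1
    ext j
    simp
  have h0 := sum_antidiagonal_hSeries_eSeries (fun l => -α l) hst (r := k)
    (by rw [Finset.card_range, hcard]; omega)
  rw [map_sum, ← h0]
  refine Finset.sum_congr rfl fun p _ => ?_
  rw [smul_eval, eval_partialHsymm, hser, mul_comm]

/-- By surjectivity all of $\alpha_0,\dots,\alpha_{k-1}$ occur among the coordinates, so
$\prod_i(1+y_i u)/\prod_{l<k}(1+\alpha_l u)$ is a polynomial of degree at most $n-k$. Its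
coefficient of $u^r$ vanishes for $r>n-k$ and has top form $e_r$. -/
theorem exists_deformation_esymm {α : ℕ → K} {r : ℕ} (hr : n + 1 ≤ r + k) :
    ∃ P ∈ vanishingIdealOfPoints
        (surjectionPoint α : {c : Fin n → Fin k // Function.Surjective c} → _),
      P - map (algebraMap F K) (esymm (Fin n) F r) ∈
        restrictSupport K {c : Fin n →₀ ℕ | c.degree < r} := by
  rw [map_esymm]
  refine ⟨_, ?_, sum_antidiagonal_sub_mem (fun a => isHomogeneous_esymm a)
    (v := fun b => PowerSeries.coeff b (hSeries (fun l => -α l) (Finset.range k)))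
    (coeff_zero_hSeries (fun l => -α l) (Finset.range k)) r⟩
  intro c
  set t := Finset.univ.image (label c.1) with ht
  have hser : eSeries (surjectionPoint α c) Finset.univ = eSeries α t := by
    rw [eSeries, eSeries, ht, Finset.prod_image (label_injective c.1).injOn]
    rfl
  have hst : Finset.range k ⊆ t := by
    intro l hl
    obtain ⟨i, hi⟩ := exists_label_eq c.2 ⟨l, Finset.mem_range.1 hl⟩
    exact Finset.mem_image.2 ⟨i, Finset.mem_univ _, hi⟩
  have hcard : t.card = n := by
    rw [ht, Finset.card_image_of_injective _ (label_injective c.1), Finset.card_univ,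
      Fintype.card_fin]
  have h0 := sum_antidiagonal_hSeries_eSeries α hst (r := r)
    (by rw [Finset.card_range, hcard]; omega)
  rw [map_sum, ← h0, ← Finset.Nat.sum_antidiagonal_swap]
  refine Finset.sum_congr rfl fun p _ => ?_
  rw [smul_eval, eval_esymm, hser]
  rfl

/-- The field `F` may be too small to supply distinct labels, so the points are taken over its
algebraic closure, which is infinite. -/
theorem card_surjections_le_card_standardMonomials (F : Type*) [Field F] {n k : ℕ}
    {m : MonomialOrder (Fin n)} (hfin : (standardMonomials m (idealJ F n k)).Finite) :
    Nat.card {c : Fin n → Fin k // Function.Surjective c} ≤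
      Nat.card (standardMonomials m (idealJ F n k)) := by
  let α : ℕ ↪ AlgebraicClosure F := Infinite.natEmbedding _
  refine card_points_le_of_span_sup (surjectionPoint_injective α.injective) hfin
    (span_monomials_sup_eq_top_of_deformation ?_ (span_standardMonomials_sup (m := m)))
  rintro _ (⟨i, rfl⟩ | ⟨r, hr, rfl⟩)
  · exact ⟨k, isHomogeneous_partialHsymm k i, exists_deformation_partialHsymm α i⟩
  · exact ⟨r, isHomogeneous_esymm r, exists_deformation_esymm hr.1⟩

end Points

theorem mainTheorem4 (F : Type*) [Field F] (n k : ℕ) (hk : 1 ≤ k) (hkn : k ≤ n) :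
    standardMonomials (neglex n) (idealJ F n k) = reverseNonskip n k ∧
    (LinearIndependent F (fun d : reverseNonskip n k =>
        (Ideal.Quotient.mk (idealJ F n k) (monomial (d : Fin n →₀ ℕ) (1 : F)) : QuotientS F n k)) ∧
      Submodule.span F (Set.range (fun d : reverseNonskip n k =>
        (Ideal.Quotient.mk (idealJ F n k) (monomial (d : Fin n →₀ ℕ) (1 : F)) : QuotientS F n k)))
          = ⊤) ∧
    (Module.Finite F (QuotientS F n k) ∧
      Module.finrank F (QuotientS F n k) = Nat.card (OrderedSetPartition n k)) := by
  have hsub := standardMonomials_subset_reverseNonskip (F := F) (n := n) k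
  have hfin := finite_reverseNonskip n k
  have h1 := card_surjections_le_card_standardMonomials F (hfin.subset hsub)
  have h2 := card_reverseNonskip_le hkn
  -- The squeeze: a subset of a finite set with at least as many elements is the whole set.
  have heq : standardMonomials (neglex n) (idealJ F n k) = reverseNonskip n k :=
    Set.eq_of_subset_of_ncard_le hsub (h2.trans h1) hfin
  have hli := linearIndependent_standardMonomials (m := neglex n) (I := idealJ F n k)
  have hsp := span_mk_standardMonomials (m := neglex n) (I := idealJ F n k)
  rw [heq] at h1 hli hsp
  have := hfin.fintype
  let b := Module.Basis.mk hli hsp.ge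
  refine ⟨heq, ⟨hli, hsp⟩, Module.Finite.of_basis b, ?_⟩
  rw [Module.finrank_eq_card_basis b, ← Nat.card_eq_fintype_card, card_orderedSetPartition]
  exact le_antisymm h2 h1
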